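/- Consider the impulsive hematopoiesis model $$\dot x(t)=-a(t)x(t)+\sum_{i=1}^m\Big[\frac{b_i(t)}{1+x^{\alpha_i}(t-\tau_i(t))}+c_i(t)\int_0^T\frac{v_i(s)}{1+x^{\beta_i}(t-s)}\,ds-H_i(t,x(t-\sigma_i(t)))\Big],\quad t\neq t_k,$$ $$x(t_k^+)-x(t_k^-)=\gamma_kx(t_k^-)+\delta_k,\quad k\in\mathbb Z,$$ where $a,b_i,c_i,\tau_i,\sigma_i:\mathbb R\to[0,\infty)$, $H_i\ge 0$ on $\mathbb R\times\mathbb R_+$ with $\mathbb R_+=[0,\infty)$, $\alpha_i,\beta_i,T>0$, $v_i\ge0$ is integrable on $[0,T]$ with $\int_0^Tv_i=1$, $\gamma_k,\delta_k\in\mathbb R$, and $(t_k)_{k\in\mathbb Z}$ is strictly increasing with $t_k\to\pm\infty$ as $k\to\pm\infty$. Definitions. A set $S\subset\mathbb R$ (or $\mathbb Z$) is relatively dense if for some $l$ every interval $[x,x+l]$, with $x$ in $\mathbb R$ (or $\mathbb Z$), meets $S$. A function $f:\mathbb R\to\mathbb R$ is Bohr almost periodic if it is continuous and for each $\epsilon>0$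 the set $\{\omega:\ |f(t+\omega)-f(t)|<\epsilon\ \forall t\}$ is relatively dense. A function $f(t,x)$ is Bohr almost periodic in $t$ uniformly in $x\in\mathbb R_+$ if it is continuous on $\mathbb R\times\mathbb R_+$ and for each compact $K\subset\mathbb R_+$ and $\epsilon>0$ the set $\{\omega:\ |f(t+\omega,x)-f(t,x)|<\epsilon\ \forall t\in\mathbb R,\,x\in K\}$ is relatively dense. A sequence $(z_k)_{k\in\mathbb Z}$ is almost periodic if for each $\epsilon>0$ the set $\{p\in\mathbb Z:\ |z_{k+p}-z_k|<\epsilon\ \forall k\}$ is relatively dense. With $t_k^p=t_{k+p}-t_k$, the set of sequences $\{t_k^p\}$ is uniformly almost periodic if for each $\epsilon>0$ the set $\{q\in\mathbb Z:\ |t^p_{k+q}-t^p_k|<\epsilon\ \forall k,p\in\mathbb Z\}$ is relatively dense. $PLC(\mathbb R,\mathbb R)$ is the set of functions $\phi:\mathbb R\to\mathbb R$ that are continuous at every $t\notin\{t_k\}$ and at each $t_k$ are left continuous with a finite right limit. A function $\phi\in PLC(\mathbb R,\mathbb R)$ is almost periodic if (i) the set of sequences $\{t_k^p\}$ is uniformly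 almost periodic; (ii) for each $\epsilon>0$ there is $\delta>0$ such that $|\phi(t)-\phi(\bar t)|<\epsilon$ whenever $t,\bar t$ lie in the same interval $(t_k,t_{k+1}]$ and $|t-\bar t|<\delta$; (iii) for each $\epsilon>0$ the set of $\omega\in\mathbb R$ such that $|\phi(t+\omega)-\phi(t)|<\epsilon$ for all $t$ with $|t-t_k|>\epsilon$ for every $k\in\mathbb Z$ is relatively dense. Assumptions, for all $i=1,\dots,m$. (A1) $a$ is Bohr almost periodic and $\inf a>0$. (A2) $b_i,c_i$ are Bohr almost periodic. (A3) $H_i$ is bounded on $\mathbb R\times\mathbb R_+$, Bohr almost periodic in $t$ uniformly in $x\in\mathbb R_+$, and for some $L_i>0$, $|H_i(t,x)-H_i(t,y)|\le L_i|x-y|$ for all $t\in\mathbb R$, $x,y\in\mathbb R_+$. (A4) $\tau_i,\sigma_i$ are Bohr almost periodic and differentiable with bounded derivatives, $\inf(1-\dot\tau_i)>0$ and $\inf(1-\dot\sigma_i)>0$. (A5) $(\delta_k)$ is almost periodic. (A6) $(\gamma_k)$ is almost periodic, $\inf_k\gamma_k>-1$, and with $\Gamma(q,p)=\prod_{i=q}^p(1+\gamma_i)$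 one has $\sup_{q\le p}\Gamma(q,p)<\infty$ and $\inf_{q\le p}\Gamma(q,p)>0$. (A7) The set of sequences $\{t_k^p\}$ is uniformly almost periodic and $\inf_k(t_{k+1}-t_k)>0$. For $s\le t$ let $$H(t,s)=\Big(\prod_{i:\ s\le t_i<t}(1+\gamma_i)\Big)\exp\Big(-\int_s^ta(r)\,dr\Big),$$ that is, $H(t,s)=\exp(-\int_s^ta)$ if $t_{k-1}<s\le t\le t_k$, and $H(t,s)=\Gamma(n,k)\exp(-\int_s^ta)$ if $t_{n-1}<s\le t_n\le t_k<t\le t_{k+1}$. For $\phi\ge0$ put $$F\phi(t)=\int_{-\infty}^tH(t,s)\sum_{i=1}^m\Big\{\frac{b_i(s)}{1+\phi^{\alpha_i}(s-\tau_i(s))}+c_i(s)\int_0^T\frac{v_i(r)}{1+\phi^{\beta_i}(s-r)}\,dr-H_i(s,\phi(s-\sigma_i(s)))\Big\}\,ds+\sum_{t_k<t}H(t,t_k)\delta_k.$$ Theorem. Assume (A1)–(A7). If $\phi\in PLC(\mathbb R,\mathbb R)$ is almost periodic and $\phi(t)\ge0$ for all $t$, then the integrals and the series defining $F\phi(t)$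 converge absolutely for every $t$, and $F\phi$ is an almost periodic function in $PLC(\mathbb R,\mathbb R)$. -/

import Mathlib

open Set Filter Topology MeasureTheory

noncomputable section

namespace Hematopoiesis

/-! ### Almost periodicity -/

/-- `S ⊆ ℝ` or `S ⊆ ℤ` is relatively dense: some length `l` is such that every interval
`[x, x + l]` contains an element of `S`. -/
def IsRelativelyDense {G : Type*} [Add G] [Preorder G] (S : Set G) : Prop :=
  ∃ l : G, ∀ x : G, (S ∩ Icc x (x + l)).Nonempty

/-- Almost periodic functions on `ℝ` in the sense of Bohr. -/
def BohrAlmostPeriodic (f : ℝ → ℝ) : Prop :=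
  Continuous f ∧ ∀ ε > 0, IsRelativelyDense {ω : ℝ | ∀ t, |f (t + ω) - f t| < ε}

/-- `f (t, x)` is almost periodic in `t` in the sense of Bohr, uniformly in `x ∈ D`: it is
continuous on `ℝ × D` and, for each compact `K ⊆ D`, the `ε`-almost periods that are common to all
`x ∈ K` form a relatively dense set. -/
def BohrAlmostPeriodicUniformly (f : ℝ → ℝ → ℝ) (D : Set ℝ) : Prop :=
  ContinuousOn (Function.uncurry f) (univ ×ˢ D) ∧
    ∀ K ⊆ D, IsCompact K → ∀ ε > 0,
      IsRelativelyDense {ω : ℝ | ∀ x ∈ K, ∀ t, |f (t + ω) x - f t x| < ε}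

/-- Almost periodic (two-sided) real sequences. -/
def AlmostPeriodicSeq (z : ℤ → ℝ) : Prop :=
  ∀ ε > 0, IsRelativelyDense {p : ℤ | ∀ k, |z (k + p) - z k| < ε}

/-- The sequences `k ↦ t (k + p) - t k`, `p ∈ ℤ`, are uniformly almost periodic: for each `ε > 0`
the `ε`-almost periods `q` that are common to all of them form a relatively dense set. -/
def UniformlyAlmostPeriodicDifferences (t : ℤ → ℝ) : Prop :=
  ∀ ε > 0, IsRelativelyDense
    {q : ℤ | ∀ p k : ℤ, |(t (k + q + p) - t (k + q)) - (t (k + p) - t k)| < ε}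

/-- The space `PLC(ℝ, ℝ)`: continuous off the points `t k`, and at each `t k` left continuous
with a finite limit from the right. -/
structure IsPLC (t : ℤ → ℝ) (φ : ℝ → ℝ) : Prop where
  continuousAt : ∀ s, (∀ k, s ≠ t k) → ContinuousAt φ s
  left_continuous : ∀ k, Tendsto φ (𝓝[<] t k) (𝓝 (φ (t k)))
  right_limit : ∀ k, ∃ y, Tendsto φ (𝓝[>] t k) (𝓝 y)

/-- Almost periodic functions in `PLC(ℝ, ℝ)`. -/
structure PiecewiseAlmostPeriodic (t : ℤ → ℝ) (φ : ℝ → ℝ) : Prop where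
  isPLC : IsPLC t φ
  differences : UniformlyAlmostPeriodicDifferences t
  uniform_continuity : ∀ ε > 0, ∃ δ > 0, ∀ k : ℤ,
    ∀ s ∈ Ioc (t k) (t (k + 1)), ∀ s' ∈ Ioc (t k) (t (k + 1)),
      |s - s'| < δ → |φ s - φ s'| < ε
  almost_periods : ∀ ε > 0, IsRelativelyDense
    {ω : ℝ | ∀ s : ℝ, (∀ k, ε < |s - t k|) → |φ (s + ω) - φ s| < ε}

/-! ### The model -/

/-- The data of the impulsive model of hematopoiesis with delays and harvesting terms,
`x'(s) = -a(s) x(s) + ∑ i, [b i s / (1 + x(s - τ i s) ^ α i)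
  + c i s * ∫ r in 0..T, v i r / (1 + x(s - r) ^ β i) - h i s (x(s - σ i s))]` for `s ≠ t k`,
`x(t k +) - x(t k -) = γ k * x(t k -) + δ k`,
with the standing sign and normalization conventions. -/
structure Model (m : ℕ) where
  a : ℝ → ℝ
  b : Fin m → ℝ → ℝ
  c : Fin m → ℝ → ℝ
  /-- the harvesting terms -/
  h : Fin m → ℝ → ℝ → ℝ
  τ : Fin m → ℝ → ℝ
  σ : Fin m → ℝ → ℝ
  α : Fin m → ℝ
  β : Fin m → ℝ
  T : ℝ
  v : Fin m → ℝ → ℝ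
  /-- the impulse times -/
  t : ℤ → ℝ
  γ : ℤ → ℝ
  δ : ℤ → ℝ
  a_nonneg : ∀ s, 0 ≤ a s
  b_nonneg : ∀ i s, 0 ≤ b i s
  c_nonneg : ∀ i s, 0 ≤ c i s
  h_nonneg : ∀ i s x, 0 ≤ x → 0 ≤ h i s x
  τ_nonneg : ∀ i s, 0 ≤ τ i s
  σ_nonneg : ∀ i s, 0 ≤ σ i s
  α_pos : ∀ i, 0 < α i
  β_pos : ∀ i, 0 < β i
  T_pos : 0 < T
  v_nonneg : ∀ i, ∀ r ∈ Icc 0 T, 0 ≤ v i r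
  v_integrable : ∀ i, IntegrableOn (v i) (Icc 0 T)
  v_integral : ∀ i, ∫ r in 0..T, v i r = 1
  t_strictMono : StrictMono t
  t_atTop : Tendsto t atTop atTop
  t_atBot : Tendsto t atBot atBot

namespace Model

variable {m : ℕ} (M : Model m)

/-- `Γ(q, p) = ∏_{i=q}^p (1 + γ_i)`, used for `q ≤ p`. -/
def Gam (q p : ℤ) : ℝ := ∏ i ∈ Finset.Icc q p, (1 + M.γ i)

/-- The Cauchy matrix `H(u, s)`, `s ≤ u`: the product of the `1 + γ i` over the finitely many `i`
with `s ≤ t i < u`, times `exp (-∫_s^u a)`. If `t (k-1) < s ≤ u ≤ t k`, the product is empty; if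
`t (n-1) < s ≤ t n ≤ t k < u ≤ t (k+1)`, it is `Γ(n, k)`. -/
def cauchy (u s : ℝ) : ℝ :=
  (∏ᶠ i ∈ {i : ℤ | s ≤ M.t i ∧ M.t i < u}, (1 + M.γ i)) * Real.exp (-∫ r in s..u, M.a r)

/-- The nonlinear terms of the equation at time `s`, along `φ`. -/
def nonlinearity (φ : ℝ → ℝ) (s : ℝ) : ℝ :=
  ∑ i, (M.b i s / (1 + φ (s - M.τ i s) ^ M.α i)
    + M.c i s * (∫ r in 0..M.T, M.v i r / (1 + φ (s - r) ^ M.β i))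
    - M.h i s (φ (s - M.σ i s)))

/-- The operator `F`. -/
def F (φ : ℝ → ℝ) (u : ℝ) : ℝ :=
  (∫ s in Iic u, M.cauchy u s * M.nonlinearity φ s)
    + ∑' k : {k : ℤ // M.t k < u}, M.cauchy u (M.t k) * M.δ k

/-! ### The assumptions; conditions such as `inf > 0` are spelled out as uniform bounds -/

/-- `a` is almost periodic with `inf a > 0`. -/
def DecayAssumption : Prop :=
  BohrAlmostPeriodic M.a ∧ ∃ a₀ > 0, ∀ s, a₀ ≤ M.a s

/-- The (nonnegative) functions `b i`, `c i` are almost periodic. -/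
def ProductionAssumption : Prop :=
  ∀ i, BohrAlmostPeriodic (M.b i) ∧ BohrAlmostPeriodic (M.c i)

/-- The (nonnegative) `h i` are bounded, almost periodic in time uniformly in `x ≥ 0`, and
Lipschitz in `x ≥ 0`. -/
def HarvestingAssumption : Prop :=
  ∀ i, (∃ C, ∀ s x, 0 ≤ x → M.h i s x ≤ C) ∧
    BohrAlmostPeriodicUniformly (M.h i) (Ici 0) ∧
    ∃ L > 0, ∀ s x y, 0 ≤ x → 0 ≤ y → |M.h i s x - M.h i s y| ≤ L * |x - y|

/-- A delay is almost periodic and differentiable, with a bounded derivative `τ'` such that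
`inf (1 - τ') > 0`. -/
def AdmissibleDelay (τ : ℝ → ℝ) : Prop :=
  BohrAlmostPeriodic τ ∧ Differentiable ℝ τ ∧ (∃ C, ∀ s, |deriv τ s| ≤ C) ∧
    ∃ κ > 0, ∀ s, κ ≤ 1 - deriv τ s

/-- All delays are admissible. -/
def DelayAssumption : Prop :=
  ∀ i, AdmissibleDelay (M.τ i) ∧ AdmissibleDelay (M.σ i)

/-- `γ` is almost periodic, `inf γ > -1`, and the products `Γ(q, p)`, `q ≤ p`, are bounded above
and bounded away from `0`. -/
def JumpFactorAssumption : Prop :=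
  AlmostPeriodicSeq M.γ ∧ (∃ g > -1, ∀ k, g ≤ M.γ k) ∧
    (∃ C, ∀ q p, q ≤ p → M.Gam q p ≤ C) ∧ ∃ c > 0, ∀ q p, q ≤ p → c ≤ M.Gam q p

/-- The differences of the impulse times are uniformly almost periodic and
`inf (t (k+1) - t k) > 0`. -/
def ImpulseTimeAssumption : Prop :=
  UniformlyAlmostPeriodicDifferences M.t ∧ ∃ η > 0, ∀ k, η ≤ M.t (k + 1) - M.t k

end Model

end Hematopoiesis

end

/-! `M.F φ` is the bounded-solution formula of the linear impulsive equation, with N =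
`M.nonlinearity φ` as inhomogeneity. N is bounded, the jumps are bounded, and the Cauchy matrix
decays exponentially, which gives convergence. Almost periodicity has to survive two obstacles.

First, relatively dense sets are not closed under intersection, and here a translation ω must be an
almost period of all coefficients while being paired with an index shift q for which t (k + q) stays
close to t k + ω. Sets containing all differences within the classes of a finite colouring do form a
filter, which absorbs finitely many conditions. Among the pairs (ω, q) that nearly translate the
impulse times, differences of equally coloured pairs meet all conditions at once and are still
relatively dense: `isRelativelyDense_differences`, `isRelativelyDense_of_eventually`.

Second, φ(s - τ s) jumps where s - τ s hits an impulse time, so N need not be piecewise almost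
periodic for the given times. It is almost periodic in measure: in every window of length R, the s
at which N(s + ω) and N(s) differ noticeably form a set of small measure. Delays preserve this
property because s ↦ s - τ s expands distances by at least a fixed factor (`inMeasure_delay`), and
the distributed delay even turns it into uniform closeness (`convolution`).

The integral against an exponentially decaying kernel does not see such small sets
(`abs_setIntegral_le_of_small_off`), and the kernel itself is almost invariant under the pairs (ω,
q) (`exists_abs_cauchy_sub_le`). Together these give `abs_response_sub_le`. The regularity of `M.F
φ` comes from a Lipschitz bound between consecutive impulses. -/

noncomputable section
namespace Hematopoiesis

/-! ### The filter of almost periods -/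

/-- The filter of sets `S` for which some finite colouring of `G` has all the differences of
equally coloured elements in `S`. -/
def almostPeriodFilter (G : Type*) [AddGroup G] : Filter G where
  sets := {S | ∃ (ι : Type) (_ : Finite ι) (c : G → ι), ∀ g g', c g = c g' → g - g' ∈ S}
  univ_sets := ⟨Unit, inferInstance, fun _ => (), fun _ _ _ => mem_univ _⟩
  sets_of_superset := by
    rintro S S' ⟨ι, hι, c, hc⟩ hS
    exact ⟨ι, hι, c, fun g g' h => hS (hc g g' h)⟩
  inter_sets := by
    rintro S S' ⟨ι, hι, c, hc⟩ ⟨ι', hι', c', hc'⟩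
    refine ⟨ι × ι', inferInstance, fun g => (c g, c' g), fun g g' h => ?_⟩
    rw [Prod.mk.injEq] at h
    exact ⟨hc g g' h.1, hc' g g' h.2⟩

/-- Colourings pull back along homomorphisms. For the two projections of ℝ × ℤ this turns conditions
on ω and on q into conditions on the pair. -/
theorem tendsto_almostPeriodFilter {G G' : Type*} [AddGroup G] [AddGroup G'] (f : G →+ G') :
    Tendsto f (almostPeriodFilter G) (almostPeriodFilter G') := by
  rintro S ⟨ι, hι, c, hc⟩
  refine ⟨ι, hι, c ∘ f, fun g g' h => ?_⟩
  rw [mem_preimage, map_sub]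
  exact hc _ _ h

theorem IsRelativelyDense.mono {G : Type*} [Add G] [Preorder G] {S S' : Set G}
    (h : IsRelativelyDense S) (hS : S ⊆ S') : IsRelativelyDense S' := by
  obtain ⟨l, hl⟩ := h
  exact ⟨l, fun x => (hl x).mono (inter_subset_inter_left _ hS)⟩

/-- Choose p x in P ∩ [x, x + l] and colour x by the cell of length δ containing the gap p x - x.
Equal colours give x - x' = p x - p x' + d with |d| < δ; the error d is why uniform continuity is
needed whenever this is applied. -/
theorem IsRelativelyDense.mem_almostPeriodFilter_real {P S : Set ℝ} (hP : IsRelativelyDense P)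
    {δ : ℝ} (hδ : 0 < δ) (h : ∀ p ∈ P, ∀ p' ∈ P, ∀ d, |d| < δ → p - p' + d ∈ S) :
    S ∈ almostPeriodFilter ℝ := by
  obtain ⟨l, hl⟩ := hP
  choose p hp hpI using hl
  refine ⟨Icc (0 : ℤ) ⌊l / δ⌋, inferInstance, fun x => ⟨⌊(p x - x) / δ⌋, ?_, ?_⟩, ?_⟩
  · exact Int.floor_nonneg.2 (div_nonneg (sub_nonneg.2 (hpI x).1) hδ.le)
  · exact Int.floor_le_floor (by gcongr; linarith [(hpI x).2])
  · intro x x' hxx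
    have h1 := Int.abs_sub_lt_one_of_floor_eq_floor (Subtype.mk.inj hxx)
    rw [← sub_div, abs_div, abs_of_pos hδ, div_lt_one hδ, abs_sub_comm] at h1
    have h2 := h _ (hp x) _ (hp x') _ h1
    convert h2 using 1
    ring

theorem IsRelativelyDense.mem_almostPeriodFilter_int {P S : Set ℤ} (hP : IsRelativelyDense P)
    (h : ∀ p ∈ P, ∀ p' ∈ P, p - p' ∈ S) : S ∈ almostPeriodFilter ℤ := by
  obtain ⟨l, hl⟩ := hP
  choose p hp hpI using hl
  refine ⟨Icc (0 : ℤ) l, inferInstance, fun x => ⟨p x - x, ?_, ?_⟩, ?_⟩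
  · exact sub_nonneg.2 (hpI x).1
  · linarith [(hpI x).2]
  · intro x x' hxx
    have h1 := Subtype.mk.inj hxx
    have h2 := h _ (hp x) _ (hp x')
    convert h2 using 1
    linarith

/-- A relatively dense set of pairs contains enough equally coloured elements: the differences
of its elements that lie in a given set of almost periods are again relatively dense. -/
theorem isRelativelyDense_differences {A S : Set (ℝ × ℤ)}
    (hA : IsRelativelyDense (Prod.fst '' A)) (hS : S ∈ almostPeriodFilter (ℝ × ℤ)) :
    IsRelativelyDense {ω : ℝ | ∃ g ∈ A, ∃ g' ∈ A, g - g' ∈ S ∧ ω = g.1 - g'.1} := by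
  obtain ⟨ι, hι, c, hc⟩ := hS
  obtain ⟨l, hl⟩ := hA
  -- One representative in `A` for each colour that occurs there; the value 0 for the other colours
  -- is never used.
  have hr : ∀ i : ι, ∃ r : ℝ × ℤ, ∀ g ∈ A, c g = i → r ∈ A ∧ c r = i := by
    intro i
    by_cases h : ∃ g ∈ A, c g = i
    · obtain ⟨g, hg, hgi⟩ := h
      exact ⟨g, fun _ _ _ => ⟨hg, hgi⟩⟩
    · exact ⟨0, fun g hg hgi => (h ⟨g, hg, hgi⟩).elim⟩
  choose r hr using hr
  obtain ⟨R, hR⟩ := (Set.finite_range fun i => |(r i).1|).bddAbove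
  have hR' : ∀ i, |(r i).1| ≤ R := fun i => hR (mem_range_self i)
  -- Representatives have first coordinate in [-R, R]. Searching `A` from x + R and subtracting one
  -- therefore lands in [x, x + 2R + l].
  refine ⟨R + R + l, fun x => ?_⟩
  obtain ⟨_, ⟨g, hgA, rfl⟩, hg⟩ := hl (x + R)
  obtain ⟨h1, h2⟩ := hr (c g) g hgA rfl
  refine ⟨g.1 - (r (c g)).1, ⟨g, hgA, _, h1, hc _ _ h2.symm, rfl⟩, ?_⟩
  have h3 := abs_le.1 (hR' (c g))
  constructor <;> linarith [hg.1, hg.2]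

/-! ### Bohr almost periodic functions and almost periodic sequences -/

theorem BohrAlmostPeriodic.uniformly {f : ℝ → ℝ} (hf : BohrAlmostPeriodic f) :
    BohrAlmostPeriodicUniformly (fun s _ => f s) univ := by
  refine ⟨(hf.1.comp continuous_fst).continuousOn, fun K _ _ ε hε => (hf.2 ε hε).mono ?_⟩
  exact fun ω hω x _ s => hω s

/-- An almost period carries s into a fixed compact window, where Heine–Cantor applies; the margin 1
of the window accommodates the shift d. -/
theorem BohrAlmostPeriodicUniformly.uniform_continuity {f : ℝ → ℝ → ℝ} {D K : Set ℝ}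
    (hf : BohrAlmostPeriodicUniformly f D) (hKD : K ⊆ D) (hK : IsCompact K) {ε : ℝ} (hε : 0 < ε) :
    ∃ δ > 0, ∀ x ∈ K, ∀ s d, |d| < δ → |f (s + d) x - f s x| < ε := by
  obtain ⟨l, hl⟩ := hf.2 K hKD hK (ε / 3) (by positivity)
  have hc : UniformContinuousOn (Function.uncurry f) (Icc (-1) (l + 1) ×ˢ K) :=
    (isCompact_Icc.prod hK).uniformContinuousOn_of_continuous
      (hf.1.mono (prod_mono (subset_univ _) hKD))
  obtain ⟨δ, hδ, h⟩ := Metric.uniformContinuousOn_iff.1 hc (ε / 3) (by positivity)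
  refine ⟨min δ 1, by positivity, fun x hx s d hd => ?_⟩
  obtain ⟨ω, hω, hωI⟩ := hl (-s)
  have hd1 : |d| < 1 := hd.trans_le (min_le_right _ _)
  have hd2 := abs_lt.1 hd1
  have h1 := h (s + ω + d, x) ⟨⟨by linarith [hωI.1], by linarith [hωI.2]⟩, hx⟩ (s + ω, x)
    ⟨⟨by linarith [hωI.1], by linarith [hωI.2]⟩, hx⟩ (by
      rw [Prod.dist_eq]
      simp only [dist_self, Real.dist_eq, add_sub_cancel_left]
      exact max_lt (hd.trans_le (min_le_left _ _)) hδ)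
  rw [Real.dist_eq] at h1
  simp only [Function.uncurry] at h1
  have h2 := hω x hx s
  have h3 := hω x hx (s + d)
  rw [add_right_comm] at h3
  rw [abs_lt] at *
  constructor <;> linarith [h1.1, h1.2, h2.1, h2.2, h3.1, h3.2]

theorem BohrAlmostPeriodicUniformly.eventually {f : ℝ → ℝ → ℝ} {D K : Set ℝ}
    (hf : BohrAlmostPeriodicUniformly f D) (hKD : K ⊆ D) (hK : IsCompact K) {ε : ℝ} (hε : 0 < ε) :
    ∀ᶠ ω in almostPeriodFilter ℝ, ∀ x ∈ K, ∀ s, |f (s + ω) x - f s x| < ε := by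
  obtain ⟨δ, hδ, h⟩ := hf.uniform_continuity hKD hK (ε := ε / 3) (by positivity)
  refine (hf.2 K hKD hK (ε / 3) (by positivity)).mem_almostPeriodFilter_real hδ ?_
  intro p hp p' hp' d hd x hx s
  have h1 := h x hx s d hd
  have h2 := hp' x hx (s + d - p')
  have h3 := hp x hx (s + d - p')
  rw [sub_add_cancel] at h2
  have e : s + (p - p' + d) = s + d - p' + p := by ring
  rw [e]
  rw [abs_lt] at *
  constructor <;> linarith [h1.1, h1.2, h2.1, h2.2, h3.1, h3.2]

theorem BohrAlmostPeriodic.eventually {f : ℝ → ℝ} (hf : BohrAlmostPeriodic f) {ε : ℝ}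
    (hε : 0 < ε) : ∀ᶠ ω in almostPeriodFilter ℝ, ∀ s, |f (s + ω) - f s| < ε := by
  filter_upwards [hf.uniformly.eventually (subset_univ {0}) isCompact_singleton hε] with ω hω s
  exact hω 0 rfl s

theorem BohrAlmostPeriodic.bounded {f : ℝ → ℝ} (hf : BohrAlmostPeriodic f) :
    ∃ B > 0, ∀ s, |f s| ≤ B := by
  obtain ⟨l, hl⟩ := hf.2 1 one_pos
  obtain ⟨B, hB⟩ := (isCompact_Icc (a := (0 : ℝ)) (b := l)).exists_bound_of_continuousOn
    hf.1.continuousOn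
  have key : ∀ s, |f s| ≤ B + 1 := by
    intro s
    obtain ⟨ω, hω, hωI⟩ := hl (-s)
    have h1 := hB (s + ω) ⟨by linarith [hωI.1], by linarith [hωI.2]⟩
    have h2 := hω s
    rw [Real.norm_eq_abs, abs_le] at h1
    rw [abs_lt] at h2
    rw [abs_le]
    constructor <;> linarith [h1.1, h1.2, h2.1, h2.2]
  exact ⟨|B + 1| + 1, by positivity, fun s => (key s).trans ((le_abs_self _).trans (by simp))⟩

theorem AlmostPeriodicSeq.eventually {z : ℤ → ℝ} (hz : AlmostPeriodicSeq z) {ε : ℝ}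
    (hε : 0 < ε) : ∀ᶠ q in almostPeriodFilter ℤ, ∀ k, |z (k + q) - z k| < ε := by
  refine (hz (ε / 2) (by positivity)).mem_almostPeriodFilter_int ?_
  intro p hp p' hp' k
  have h1 := hp (k - p')
  have h2 := hp' (k - p')
  rw [sub_add_cancel] at h2
  rw [show k + (p - p') = k - p' + p by ring]
  rw [abs_lt] at *
  constructor <;> linarith [h1.1, h1.2, h2.1, h2.2]

theorem AlmostPeriodicSeq.bounded {z : ℤ → ℝ} (hz : AlmostPeriodicSeq z) :
    ∃ B > 0, ∀ k, |z k| ≤ B := by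
  obtain ⟨l, hl⟩ := hz 1 one_pos
  obtain ⟨B, hB⟩ := ((Set.finite_Icc (0 : ℤ) l).image fun k => |z k|).bddAbove
  have key : ∀ s, |z s| ≤ B + 1 := by
    intro s
    obtain ⟨q, hq, hqI⟩ := hl (-s)
    have h1 : |z (s + q)| ≤ B :=
      hB ⟨s + q, ⟨by linarith [hqI.1], by linarith [hqI.2]⟩, rfl⟩
    have h2 := hq s
    rw [abs_le] at h1
    rw [abs_lt] at h2
    rw [abs_le]
    constructor <;> linarith [h1.1, h1.2, h2.1, h2.2]
  exact ⟨|B + 1| + 1, by positivity, fun s => (key s).trans ((le_abs_self _).trans (by simp))⟩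

/-! ### Sequences of impulse times -/

/-- The least `i` with `s ≤ t i`. -/
def firstIndex (t : ℤ → ℝ) (s : ℝ) : ℤ := sInf {i | s ≤ t i}

/-- Strictly increasing sequences of times without finite accumulation points. -/
structure IsTimeSequence (t : ℤ → ℝ) : Prop where
  strictMono : StrictMono t
  atTop : Tendsto t atTop atTop
  atBot : Tendsto t atBot atBot

namespace IsTimeSequence

variable {t : ℤ → ℝ}

/-- This Galois connection reduces every question about indices to a comparison of times. -/
theorem firstIndex_le_iff (ht : IsTimeSequence t) {s : ℝ} {i : ℤ} :
    firstIndex t s ≤ i ↔ s ≤ t i := by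
  have hne : {i | s ≤ t i}.Nonempty := (ht.atTop.eventually_ge_atTop s).exists
  have hbd : BddBelow {i | s ≤ t i} := by
    obtain ⟨j, hj⟩ := (ht.atBot.eventually_lt_atBot s).exists
    exact ⟨j, fun i hi => (ht.strictMono.lt_iff_lt.1 (hj.trans_le hi)).le⟩
  refine ⟨fun h => ?_, fun h => csInf_le hbd h⟩
  have h1 : s ≤ t (firstIndex t s) := Int.csInf_mem hne hbd
  exact h1.trans (ht.strictMono.monotone h)

theorem lt_firstIndex_iff (ht : IsTimeSequence t) {s : ℝ} {i : ℤ} :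
    i < firstIndex t s ↔ t i < s := by
  rw [← not_le, ht.firstIndex_le_iff, not_le]

theorem firstIndex_apply (ht : IsTimeSequence t) (k : ℤ) : firstIndex t (t k) = k :=
  le_antisymm (ht.firstIndex_le_iff.2 le_rfl)
    (ht.strictMono.le_iff_le.1 (ht.firstIndex_le_iff.1 le_rfl))

theorem firstIndex_mono (ht : IsTimeSequence t) : Monotone (firstIndex t) := fun _ _ h =>
  ht.firstIndex_le_iff.2 (h.trans (ht.firstIndex_le_iff.1 le_rfl))

theorem le_apply_firstIndex (ht : IsTimeSequence t) (s : ℝ) : s ≤ t (firstIndex t s) :=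
  ht.firstIndex_le_iff.1 le_rfl

theorem apply_lt_of_lt_firstIndex (ht : IsTimeSequence t) {s : ℝ} {i : ℤ}
    (h : i < firstIndex t s) : t i < s := ht.lt_firstIndex_iff.1 h

theorem firstIndex_eq_iff (ht : IsTimeSequence t) {s : ℝ} {i : ℤ} :
    firstIndex t s = i ↔ t (i - 1) < s ∧ s ≤ t i := by
  rw [← ht.lt_firstIndex_iff, ← ht.firstIndex_le_iff]
  omega

theorem mul_sub_le {η : ℝ} (h : ∀ k, η ≤ t (k + 1) - t k) {n k : ℤ}
    (hnk : n ≤ k) : η * (k - n) ≤ t k - t n := by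
  induction k, hnk using Int.leInduction with
  | base => simp
  | succ k _ ih => push_cast; nlinarith [h k]

theorem sub_le_mul {η : ℝ} (h : ∀ k, t (k + 1) - t k ≤ η) {n k : ℤ}
    (hnk : n ≤ k) : t k - t n ≤ η * (k - n) := by
  induction k, hnk using Int.leInduction with
  | base => simp
  | succ k _ ih => push_cast; nlinarith [h k]

theorem firstIndex_sub_le (ht : IsTimeSequence t) {η : ℝ} (hη : 0 < η)
    (h : ∀ k, η ≤ t (k + 1) - t k) {s u : ℝ} (hsu : s ≤ u) :
    ((firstIndex t u - firstIndex t s : ℤ) : ℝ) ≤ (u - s) / η + 1 := by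
  have h0 := div_nonneg (sub_nonneg.2 hsu) hη.le
  rcases le_or_gt (firstIndex t u) (firstIndex t s) with h1 | h1
  · have : ((firstIndex t u - firstIndex t s : ℤ) : ℝ) ≤ 0 := by
      exact_mod_cast sub_nonpos.2 h1
    linarith
  · have h2 := mul_sub_le h (n := firstIndex t s) (k := firstIndex t u - 1) (by omega)
    have h3 := ht.apply_lt_of_lt_firstIndex (s := u) (i := firstIndex t u - 1) (by omega)
    have h4 := ht.le_apply_firstIndex s
    rw [← sub_le_iff_le_add, le_div_iff₀ hη]
    push_cast at *
    nlinarith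

/-- Simultaneous approximate translations of the times and of their indices. -/
theorem isRelativelyDense_translations (ht : IsTimeSequence t)
    (h : UniformlyAlmostPeriodicDifferences t) {ε : ℝ} (hε : 0 < ε) :
    IsRelativelyDense (Prod.fst '' {g : ℝ × ℤ | ∀ k, |t (k + g.2) - t k - g.1| < ε}) := by
  have hgap : AlmostPeriodicSeq fun k => t (k + 1) - t k := by
    intro ε hε
    exact (h ε hε).mono fun q hq k => hq 1 k
  obtain ⟨B, hB0, hB⟩ := hgap.bounded
  obtain ⟨l, hl⟩ := h ε hε
  -- B bounds the gaps. With q in [n, n + l], the time t q lies beyond x + t 0, while t (n - 1) lies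
  -- before it and at most l + 1 gaps below t q.
  refine ⟨B * (l + 1), fun x => ?_⟩
  set n := firstIndex t (x + t 0) with hn
  obtain ⟨q, hq, hqI⟩ := hl n
  refine ⟨t q - t 0, ⟨(t q - t 0, q), fun k => ?_, rfl⟩, ?_, ?_⟩
  · have := hq k 0
    simp only [zero_add] at this
    rw [add_comm q k] at this
    convert this using 2
    ring
  · linarith [ht.le_apply_firstIndex (x + t 0), ht.strictMono.monotone hqI.1]
  · have h1 := sub_le_mul (fun k => (le_abs_self _).trans (hB k)) (n := n - 1) (k := q)
      (by linarith [hqI.1])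
    have h2 := ht.apply_lt_of_lt_firstIndex (s := x + t 0) (i := n - 1) (by omega)
    have h3 : (q : ℝ) ≤ n + l := by exact_mod_cast hqI.2
    have h4 : B * (q - n + 1) ≤ B * (l + 1) := by gcongr; linarith
    push_cast at h1
    nlinarith

/-- Almost periods of everything at once. -/
theorem isRelativelyDense_of_eventually (ht : IsTimeSequence t)
    (h : UniformlyAlmostPeriodicDifferences t) {ε : ℝ} (hε : 0 < ε) {p : ℝ → Prop} {r : ℤ → Prop}
    (hp : ∀ᶠ ω in almostPeriodFilter ℝ, p ω) (hr : ∀ᶠ q in almostPeriodFilter ℤ, r q) :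
    IsRelativelyDense {ω | p ω ∧ ∃ q, r q ∧ ∀ k, |t (k + q) - t k - ω| < ε} := by
  have hS := ((tendsto_almostPeriodFilter (AddMonoidHom.fst ℝ ℤ)).eventually hp).and
    ((tendsto_almostPeriodFilter (AddMonoidHom.snd ℝ ℤ)).eventually hr)
  refine (isRelativelyDense_differences
    (ht.isRelativelyDense_translations h (half_pos hε)) hS).mono ?_
  rintro ω ⟨g, hg, g', hg', ⟨h1, h2⟩, rfl⟩
  refine ⟨h1, _, h2, fun k => ?_⟩
  have h3 := hg (k - g'.2)
  have h4 := hg' (k - g'.2)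
  rw [sub_add_cancel] at h4
  simp only [AddMonoidHom.coe_snd, Prod.snd_sub]
  rw [show k + (g.2 - g'.2) = k - g'.2 + g.2 by ring]
  rw [abs_lt] at *
  constructor <;> linarith [h3.1, h3.2, h4.1, h4.2]

/-- The translated times miss their targets by less than ε, so a point at distance at least ε from
all times cannot pass one of them. -/
theorem firstIndex_add_eq (ht : IsTimeSequence t) {ε ω : ℝ} {q : ℤ}
    (hq : ∀ k, |t (k + q) - t k - ω| < ε) {s : ℝ} (hs : ∀ k, ε ≤ |s - t k|) :
    firstIndex t (s + ω) = firstIndex t s + q := by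
  obtain ⟨h1, h2⟩ := ht.firstIndex_eq_iff.1 (rfl : firstIndex t s = _)
  have h3 := hs (firstIndex t s - 1)
  have h4 := hs (firstIndex t s)
  rw [abs_of_pos (by linarith)] at h3
  rw [abs_of_nonpos (by linarith)] at h4
  have h5 := abs_lt.1 (hq (firstIndex t s - 1))
  have h6 := abs_lt.1 (hq (firstIndex t s))
  rw [ht.firstIndex_eq_iff, show firstIndex t s + q - 1 = firstIndex t s - 1 + q by ring]
  constructor <;> linarith [h5.1, h5.2, h6.1, h6.2]

/-- The neighbourhoods of the times have small density. -/
theorem exists_volume_nhds_le (ht : IsTimeSequence t) {η : ℝ} (hη : 0 < η)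
    (h : ∀ k, η ≤ t (k + 1) - t k) {R ε : ℝ} (hR : 0 < R) (hε : 0 < ε) :
    ∃ ρ > 0, ∀ ρ' ≤ ρ, ∀ x,
      volume {y ∈ Icc x (x + R) | ∃ k, |y - t k| ≤ ρ'} ≤ ENNReal.ofReal ε := by
  -- A bound for the number of times in [x - ρ, x + R + 2ρ), where ρ ≤ 1. The right end uses 2ρ
  -- because `firstIndex` counts times strictly below its argument.
  set N := (R + 3) / η + 1 with hN
  have hN0 : 0 < N := by positivity
  refine ⟨min 1 (ε / (2 * N)), by positivity, fun ρ' hρ' x => ?_⟩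
  set ρ := min 1 (ε / (2 * N)) with hρ
  have hρ0 : 0 < ρ := by positivity
  set n := firstIndex t (x - ρ)
  set m := firstIndex t (x + R + 2 * ρ)
  have hsub : {y ∈ Icc x (x + R) | ∃ k, |y - t k| ≤ ρ'} ⊆
      ⋃ k ∈ Finset.Ico n m, Icc (t k - ρ) (t k + ρ) := by
    rintro y ⟨hy, k, hk⟩
    have hk := abs_le.1 (hk.trans hρ')
    refine mem_biUnion (x := k) ?_ ⟨by linarith [hk.1], by linarith [hk.2]⟩
    rw [Finset.coe_Ico, mem_Ico, ht.firstIndex_le_iff, ht.lt_firstIndex_iff]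
    constructor <;> linarith [hk.1, hk.2, hy.1, hy.2]
  have hcard := ht.firstIndex_sub_le hη h (s := x - ρ) (u := x + R + 2 * ρ) (by linarith)
  have hnm : n ≤ m := ht.firstIndex_mono (by linarith)
  have hcard' : ((m - n).toNat : ℝ) ≤ N := by
    have : ((m - n).toNat : ℝ) = ((m - n : ℤ) : ℝ) := by
      exact_mod_cast Int.toNat_of_nonneg (sub_nonneg.2 hnm)
    rw [this]
    refine hcard.trans ?_
    rw [hN]
    gcongr
    linarith [min_le_left (1 : ℝ) (ε / (2 * N))]
  calc _ ≤ volume (⋃ k ∈ Finset.Ico n m, Icc (t k - ρ) (t k + ρ)) := measure_mono hsub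
    _ ≤ ∑ k ∈ Finset.Ico n m, volume (Icc (t k - ρ) (t k + ρ)) := measure_biUnion_finset_le _ _
    _ = ∑ k ∈ Finset.Ico n m, ENNReal.ofReal (2 * ρ) := by
        refine Finset.sum_congr rfl fun k _ => ?_
        rw [Real.volume_Icc]
        congr 1
        ring
    _ = ENNReal.ofReal ((m - n).toNat * (2 * ρ)) := by
        rw [Finset.sum_const, Int.card_Ico, nsmul_eq_mul, ENNReal.ofReal_mul (Nat.cast_nonneg _),
          ENNReal.ofReal_natCast]
    _ ≤ ENNReal.ofReal ε := by
        refine ENNReal.ofReal_le_ofReal ?_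
        calc ((m - n).toNat : ℝ) * (2 * ρ) ≤ N * (2 * (ε / (2 * N))) := by
              gcongr
              exact min_le_right _ _
          _ = ε := by field_simp

end IsTimeSequence

/-! ### Almost periodicity in measure -/

/-- θ is antilipschitz, and on ℝ Lebesgue measure is one-dimensional Hausdorff measure. No
measurability of E is needed. -/
theorem volume_preimage_le {θ : ℝ → ℝ} {κ : ℝ} (hκ : 0 < κ)
    (hθ : ∀ s s', κ * |s - s'| ≤ |θ s - θ s'|) (E : Set ℝ) :
    volume (θ ⁻¹' E) ≤ ENNReal.ofReal κ⁻¹ * volume E := by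
  have h : AntilipschitzWith κ⁻¹.toNNReal θ := AntilipschitzWith.of_le_mul_dist fun s s' => by
    rw [Real.coe_toNNReal _ (by positivity), Real.dist_eq, Real.dist_eq, inv_mul_eq_div,
      le_div_iff₀ hκ, mul_comm]
    exact hθ s s'
  have h1 := h.hausdorffMeasure_preimage_le zero_le_one E
  rwa [ENNReal.rpow_one, hausdorffMeasure_real] at h1

theorem volume_setOf_comp_le {θ : ℝ → ℝ} {κ C R : ℝ} (hκ : 0 < κ)
    (h1 : ∀ s s', s ≤ s' → κ * (s' - s) ≤ θ s' - θ s)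
    (h2 : ∀ s s', s ≤ s' → θ s' - θ s ≤ C * (s' - s)) (hC : 0 ≤ C) (p : ℝ → Prop) (x : ℝ) :
    volume {s ∈ Icc x (x + R) | p (θ s)} ≤
      ENNReal.ofReal κ⁻¹ * volume {y ∈ Icc (θ x) (θ x + C * R) | p y} := by
  refine le_trans (measure_mono ?_) (volume_preimage_le hκ (θ := θ) ?_ _)
  · rintro s ⟨hs, hp⟩
    have h3 := h1 x s hs.1
    have h4 := h2 x s hs.1
    have h5 : C * (s - x) ≤ C * R := by gcongr; linarith [hs.2]
    have h6 : 0 ≤ κ * (s - x) := mul_nonneg hκ.le (sub_nonneg.2 hs.1)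
    exact ⟨⟨by linarith, by linarith⟩, hp⟩
  · intro s s'
    rcases le_total s s' with h | h
    · rw [abs_sub_comm, abs_of_nonneg (sub_nonneg.2 h), abs_sub_comm]
      exact (h1 s s' h).trans (le_abs_self _)
    · rw [abs_of_nonneg (sub_nonneg.2 h)]
      exact (h1 s' s h).trans (le_abs_self _)

theorem volume_setOf_add_le {R : ℝ} (p : ℝ → Prop) (x e : ℝ) :
    volume {s ∈ Icc x (x + R) | p (s + e)} ≤
      volume {y ∈ Icc (x + e) (x + e + R) | p y} := by
  have := volume_setOf_comp_le (θ := fun s => s + e) (κ := 1) (C := 1) (R := R) one_pos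
    (fun s s' _ => by linarith) (fun s s' _ => by linarith) zero_le_one p x
  simpa using this

theorem volume_setOf_or_le {R a b c x : ℝ} (ha : 0 ≤ a) (hb : 0 ≤ b) (hab : a + b ≤ c)
    {p q r : ℝ → Prop}
    (hp : volume {s ∈ Icc x (x + R) | p s} ≤ ENNReal.ofReal a)
    (hq : volume {s ∈ Icc x (x + R) | q s} ≤ ENNReal.ofReal b)
    (h : ∀ s, r s → p s ∨ q s) :
    volume {s ∈ Icc x (x + R) | r s} ≤ ENNReal.ofReal c := by
  calc _ ≤ volume ({s ∈ Icc x (x + R) | p s} ∪ {s ∈ Icc x (x + R) | q s}) := by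
        refine measure_mono ?_
        rintro s ⟨hs, hr⟩
        exact (h s hr).imp (fun h => ⟨hs, h⟩) fun h => ⟨hs, h⟩
    _ ≤ _ := measure_union_le _ _
    _ ≤ ENNReal.ofReal a + ENNReal.ofReal b := add_le_add hp hq
    _ = ENNReal.ofReal (a + b) := (ENNReal.ofReal_add ha hb).symm
    _ ≤ _ := ENNReal.ofReal_le_ofReal hab

/-- For most `ω`, the translate of `f` by `ω` is close to `f` outside a set of small density. -/
def AlmostPeriodicInMeasure (f : ℝ → ℝ) : Prop :=
  ∀ R > 0, ∀ ε > 0, ∀ᶠ ω in almostPeriodFilter ℝ, ∀ x,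
    volume {s ∈ Icc x (x + R) | ε ≤ |f (s + ω) - f s|} ≤ ENNReal.ofReal ε

theorem AlmostPeriodicInMeasure.of_uniform {f : ℝ → ℝ}
    (h : ∀ ε > 0, ∀ᶠ ω in almostPeriodFilter ℝ, ∀ s, |f (s + ω) - f s| < ε) :
    AlmostPeriodicInMeasure f := by
  intro R _ ε hε
  filter_upwards [h ε hε] with ω hω x
  have : {s ∈ Icc x (x + R) | ε ≤ |f (s + ω) - f s|} = ∅ :=
    eq_empty_of_forall_notMem fun s hs => (hω s).not_ge hs.2
  rw [this, measure_empty]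
  exact zero_le

theorem BohrAlmostPeriodic.inMeasure {f : ℝ → ℝ} (h : BohrAlmostPeriodic f) :
    AlmostPeriodicInMeasure f := .of_uniform fun _ hε => h.eventually hε

namespace AlmostPeriodicInMeasure

/-- If the oscillation of `f` is controlled by those of `g` and `h`, then almost periodicity is
inherited. -/
theorem of_controlled {f g h : ℝ → ℝ} (hg : AlmostPeriodicInMeasure g)
    (hh : AlmostPeriodicInMeasure h)
    (H : ∀ ε > 0, ∃ δ > 0, ∀ᶠ ω in almostPeriodFilter ℝ, ∀ s, |g (s + ω) - g s| < δ →
      |h (s + ω) - h s| < δ → |f (s + ω) - f s| < ε) :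
    AlmostPeriodicInMeasure f := by
  intro R hR ε hε
  obtain ⟨δ, hδ, h0⟩ := H ε hε
  have hm : 0 < min δ (ε / 2) := by positivity
  filter_upwards [h0, hg R hR _ hm, hh R hR _ hm] with ω h0 h1 h2 x
  refine volume_setOf_or_le hm.le hm.le ?_ (h1 x) (h2 x) ?_
  · linarith [min_le_right δ (ε / 2)]
  · intro s hs
    by_contra! hc
    exact hs.not_gt (h0 s (hc.1.trans_le (min_le_left _ _)) (hc.2.trans_le (min_le_left _ _)))

theorem add {f g : ℝ → ℝ} (hf : AlmostPeriodicInMeasure f) (hg : AlmostPeriodicInMeasure g) :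
    AlmostPeriodicInMeasure fun s => f s + g s := by
  refine of_controlled hf hg fun ε hε => ⟨ε / 2, by positivity, .of_forall fun ω s h1 h2 => ?_⟩
  rw [abs_lt] at *
  constructor <;> linarith [h1.1, h1.2, h2.1, h2.2]

theorem sub {f g : ℝ → ℝ} (hf : AlmostPeriodicInMeasure f) (hg : AlmostPeriodicInMeasure g) :
    AlmostPeriodicInMeasure fun s => f s - g s := by
  refine of_controlled hf hg fun ε hε => ⟨ε / 2, by positivity, .of_forall fun ω s h1 h2 => ?_⟩
  rw [abs_lt] at *
  constructor <;> linarith [h1.1, h1.2, h2.1, h2.2]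

theorem mul {f g : ℝ → ℝ} (hf : AlmostPeriodicInMeasure f) (hg : AlmostPeriodicInMeasure g)
    {A B : ℝ} (hA : ∀ s, |f s| ≤ A) (hB : ∀ s, |g s| ≤ B) :
    AlmostPeriodicInMeasure fun s => f s * g s := by
  have hA0 : 0 ≤ A := (abs_nonneg _).trans (hA 0)
  have hB0 : 0 ≤ B := (abs_nonneg _).trans (hB 0)
  refine of_controlled hf hg fun ε hε =>
    ⟨ε / (A + B + 1), by positivity, .of_forall fun ω s h1 h2 => ?_⟩
  set δ := ε / (A + B + 1) with hδ
  have hδ0 : 0 < δ := by positivity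
  calc |f (s + ω) * g (s + ω) - f s * g s|
      = |f (s + ω) * (g (s + ω) - g s) + (f (s + ω) - f s) * g s| := by ring_nf
    _ ≤ |f (s + ω)| * |g (s + ω) - g s| + |f (s + ω) - f s| * |g s| := by
        rw [← abs_mul, ← abs_mul]; exact abs_add_le _ _
    _ ≤ A * δ + δ * B := by gcongr <;> simp_all
    _ < (A + B + 1) * δ := by linarith
    _ = ε := by rw [hδ]; field_simp

theorem sum {ι : Type*} (I : Finset ι) {f : ι → ℝ → ℝ}
    (hf : ∀ i, AlmostPeriodicInMeasure (f i)) :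
    AlmostPeriodicInMeasure fun s => ∑ i ∈ I, f i s := by
  classical
  induction I using Finset.induction_on with
  | empty =>
    refine of_uniform fun ε hε => .of_forall fun ω s => ?_
    simpa using hε
  | insert i I hi ih =>
    simp only [Finset.sum_insert hi]
    exact (hf i).add ih

theorem comp {f p : ℝ → ℝ} {D : Set ℝ} (hf : AlmostPeriodicInMeasure f)
    (hp : UniformContinuousOn p D) (hD : ∀ s, f s ∈ D) :
    AlmostPeriodicInMeasure fun s => p (f s) := by
  refine of_controlled hf hf fun ε hε => ?_
  obtain ⟨δ, hδ, h⟩ := Metric.uniformContinuousOn_iff.1 hp ε hε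
  exact ⟨δ, hδ, .of_forall fun ω s h1 _ => h _ (hD _) _ (hD _) h1⟩

/-- The change of the time argument is handled by almost periods common to all x ∈ K, the change of
f by the Lipschitz condition. -/
theorem comp_lipschitz {f : ℝ → ℝ} {h : ℝ → ℝ → ℝ} {D K : Set ℝ} {L : ℝ}
    (hf : AlmostPeriodicInMeasure f) (hh : BohrAlmostPeriodicUniformly h D) (hKD : K ⊆ D)
    (hK : IsCompact K) (hfK : ∀ s, f s ∈ K) (hL : 0 < L)
    (hLip : ∀ s, ∀ x ∈ K, ∀ y ∈ K, |h s x - h s y| ≤ L * |x - y|) :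
    AlmostPeriodicInMeasure fun s => h s (f s) := by
  refine of_controlled hf hf fun ε hε => ⟨ε / (2 * L), by positivity, ?_⟩
  filter_upwards [hh.eventually hKD hK (half_pos hε)] with ω hω s h1 _
  have h2 := hω _ (hfK s) s
  have h3 := hLip (s + ω) _ (hfK (s + ω)) _ (hfK s)
  have h4 : L * |f (s + ω) - f s| < ε / 2 := by
    calc _ < L * (ε / (2 * L)) := by gcongr
      _ = ε / 2 := by field_simp
  calc |h (s + ω) (f (s + ω)) - h s (f s)|
      ≤ |h (s + ω) (f (s + ω)) - h (s + ω) (f s)| + |h (s + ω) (f s) - h s (f s)| :=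
        abs_sub_le _ _ _
    _ < ε := by linarith

/-- Convolutions with integrable kernels are almost periodic in the sense of Bohr. -/
theorem convolution {g v : ℝ → ℝ} {T B : ℝ} (hg : AlmostPeriodicInMeasure g)
    (hgm : Measurable g) (hgB : ∀ s, |g s| ≤ B) (hT : 0 < T)
    (hv : IntegrableOn v (Icc 0 T)) :
    ∀ ε > 0, ∀ᶠ ω in almostPeriodFilter ℝ, ∀ s,
      |(∫ r in 0..T, v r * g (s + ω - r)) - ∫ r in 0..T, v r * g (s - r)| < ε := by
  intro ε hε
  have hB0 : 0 ≤ B := (abs_nonneg _).trans (hgB 0)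
  have hv' : Integrable v (volume.restrict (Ioc 0 T)) := hv.mono_set Ioc_subset_Icc_self
  set V := ∫ r in Ioc 0 T, |v r| with hV
  have hV0 : 0 ≤ V := integral_nonneg fun _ => abs_nonneg _
  set δ := ε / (2 * (V + 1)) with hδ
  have hδ0 : 0 < δ := by positivity
  set δ' := ε / (2 * (2 * B + 1)) with hδ'
  have hδ'0 : 0 < δ' := by positivity
  -- Absolute continuity of the integral of |v|: on the small set where g changes noticeably, only
  -- the bound 2B is available, but |v| has little mass there.
  obtain ⟨μ₀, hμ₀, hμ⟩ := exists_pos_setLIntegral_lt_of_measure_lt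
    (f := fun r => ‖v r‖ₑ) hv'.2.ne (ε := ENNReal.ofReal δ') (by simpa using hδ'0)
  obtain ⟨ρ, hρ0, hρ⟩ : ∃ ρ : ℝ, 0 < ρ ∧ ENNReal.ofReal ρ < μ₀ := by
    rcases eq_or_ne μ₀ ⊤ with rfl | h
    · exact ⟨1, one_pos, ENNReal.ofReal_lt_top⟩
    · refine ⟨μ₀.toReal / 2, by have := ENNReal.toReal_pos hμ₀.ne' h; positivity, ?_⟩
      rw [ENNReal.ofReal_lt_iff_lt_toReal (by positivity) h]
      have := ENNReal.toReal_pos hμ₀.ne' h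
      linarith
  filter_upwards [hg T hT (min ρ δ) (by positivity)] with ω hω s
  set A := {r | min ρ δ ≤ |g (s + ω - r) - g (s - r)|} with hA
  have hmeas : ∀ u : ℝ, Measurable fun r => g (u - r) := fun u =>
    hgm.comp (measurable_const.sub measurable_id)
  have hAm : MeasurableSet A :=
    measurableSet_le measurable_const ((hmeas (s + ω)).sub (hmeas s)).norm
  have hAv : volume.restrict (Ioc 0 T) A < μ₀ := by
    rw [Measure.restrict_apply hAm]
    refine lt_of_le_of_lt ?_ hρ
    have h1 := volume_preimage_le (θ := fun r => s - r) one_pos (fun r r' => by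
      rw [one_mul, abs_sub_comm r r']; apply le_of_eq; congr 1; ring)
      {y ∈ Icc (s - T) (s - T + T) | min ρ δ ≤ |g (y + ω) - g y|}
    rw [inv_one, ENNReal.ofReal_one, one_mul] at h1
    refine (measure_mono ?_).trans (h1.trans ((hω (s - T)).trans
      (ENNReal.ofReal_le_ofReal (min_le_left _ _))))
    rintro r ⟨hr, hrT⟩
    refine ⟨⟨by linarith [hrT.2], by linarith [hrT.1]⟩, ?_⟩
    rw [sub_add_eq_add_sub]
    exact hr
  have hI : ∀ u, Integrable (fun r => v r * g (u - r)) (volume.restrict (Ioc 0 T)) := fun u =>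
    hv'.mul_bdd (c := B) (hmeas u).aestronglyMeasurable (.of_forall fun r => hgB _)
  have hAI : ∫ r in A, |v r| ∂(volume.restrict (Ioc 0 T)) ≤ δ' := by
    have h1 := hμ A hAv
    rw [integral_eq_lintegral_of_nonneg_ae (.of_forall fun _ => abs_nonneg _)
      hv'.norm.integrableOn.aestronglyMeasurable]
    refine ENNReal.toReal_le_of_le_ofReal hδ'0.le (le_trans (le_of_eq ?_) h1.le)
    refine lintegral_congr fun r => ?_
    rw [← Real.norm_eq_abs, ofReal_norm]
  rw [intervalIntegral.integral_of_le hT.le, intervalIntegral.integral_of_le hT.le,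
    ← integral_sub (hI _) (hI _)]
  have hle : ∀ r, ‖v r * g (s + ω - r) - v r * g (s - r)‖ ≤
      δ * |v r| + 2 * B * A.indicator (fun r => |v r|) r := by
    intro r
    rw [← mul_sub, norm_mul, Real.norm_eq_abs, Real.norm_eq_abs]
    by_cases hr : r ∈ A
    · rw [indicator_of_mem hr]
      have : |g (s + ω - r) - g (s - r)| ≤ 2 * B := by
        refine (abs_sub _ _).trans ?_
        linarith [hgB (s + ω - r), hgB (s - r)]
      have h3 : |v r| * |g (s + ω - r) - g (s - r)| ≤ |v r| * (2 * B) := by gcongr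
      have h4 : 0 ≤ δ * |v r| := by positivity
      linarith
    · rw [indicator_of_notMem hr, mul_zero, add_zero, mul_comm]
      gcongr
      have h5 : |g (s + ω - r) - g (s - r)| < min ρ δ := not_le.1 hr
      exact h5.le.trans (min_le_right _ _)
  have hi1 : Integrable (fun r => δ * |v r|) (volume.restrict (Ioc 0 T)) := hv'.norm.const_mul _
  have hi2 : Integrable (fun r => 2 * B * A.indicator (fun r => |v r|) r)
    (volume.restrict (Ioc 0 T)) := (hv'.norm.indicator hAm).const_mul _
  calc _ ≤ ∫ r in Ioc 0 T, (δ * |v r| + 2 * B * A.indicator (fun r => |v r|) r) :=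
        norm_integral_le_of_norm_le (hi1.add hi2) (.of_forall hle)
    _ = δ * V + 2 * B * ∫ r in A, |v r| ∂(volume.restrict (Ioc 0 T)) := by
        rw [integral_add hi1 hi2, integral_const_mul, integral_const_mul, integral_indicator hAm]
    _ ≤ δ * V + 2 * B * δ' := by gcongr
    _ < δ * (V + 1) + (2 * B + 1) * δ' := by linarith
    _ = ε := by rw [hδ, hδ']; field_simp; ring

end AlmostPeriodicInMeasure

/-! ### Piecewise almost periodic functions -/

theorem IsPLC.tendsto_left {t : ℤ → ℝ} {φ : ℝ → ℝ} (h : IsPLC t φ) (s : ℝ) :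
    Tendsto φ (𝓝[<] s) (𝓝 (φ s)) := by
  by_cases hs : ∃ k, s = t k
  · obtain ⟨k, rfl⟩ := hs
    exact h.left_continuous k
  · push Not at hs
    exact (h.continuousAt s hs).tendsto.mono_left nhdsWithin_le_nhds

theorem IsPLC.measurable {t : ℤ → ℝ} {φ : ℝ → ℝ} (h : IsPLC t φ) : Measurable φ := by
  set c : Set ℝ := range t
  have hc : c.Countable := countable_range t
  refine measurable_of_restrict_of_restrict_compl hc.measurableSet ?_ ?_
  · have := hc.to_subtype
    exact measurable_of_countable _
  · refine Continuous.measurable (continuousOn_iff_continuous_domRestrict.1 fun s hs => ?_)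
    exact (h.continuousAt s fun k hk => hs ⟨k, hk.symm⟩).continuousWithinAt

/-- One-sided limits at every point give local boundedness, and compactness makes it global. -/
theorem IsPLC.bounded_on_compact {t : ℤ → ℝ} {φ : ℝ → ℝ} (h : IsPLC t φ) {K : Set ℝ}
    (hK : IsCompact K) : ∃ B, ∀ s ∈ K, |φ s| ≤ B := by
  refine hK.induction_on (p := fun S => ∃ B, ∀ s ∈ S, |φ s| ≤ B) ⟨0, by simp⟩ ?_ ?_ ?_
  · rintro S S' hS ⟨B, hB⟩
    exact ⟨B, fun s hs => hB s (hS hs)⟩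
  · rintro S S' ⟨B, hB⟩ ⟨B', hB'⟩
    refine ⟨max B B', fun s hs => hs.elim (fun hs => (hB s hs).trans (le_max_left _ _))
      fun hs => (hB' s hs).trans (le_max_right _ _)⟩
  · intro s _
    have hr : ∃ y, Tendsto φ (𝓝[>] s) (𝓝 y) := by
      by_cases hs : ∃ k, s = t k
      · obtain ⟨k, rfl⟩ := hs
        exact h.right_limit k
      · push Not at hs
        exact ⟨_, (h.continuousAt s hs).tendsto.mono_left nhdsWithin_le_nhds⟩
    obtain ⟨y, hy⟩ := hr
    have h1 := (h.tendsto_left s).abs.eventually_lt_const (lt_add_one |φ s|)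
    have h2 := hy.abs.eventually_lt_const (lt_add_one |y|)
    refine ⟨{z | |φ z| ≤ max (|φ s| + 1) (|y| + 1)}, mem_nhdsWithin_of_mem_nhds ?_, _,
      fun z hz => hz⟩
    rw [← nhdsNE_sup_pure, ← nhdsLT_sup_nhdsGT, mem_sup, mem_sup]
    refine ⟨⟨?_, ?_⟩, ?_⟩
    · filter_upwards [h1] with z hz using hz.le.trans (le_max_left _ _)
    · filter_upwards [h2] with z hz using hz.le.trans (le_max_right _ _)
    · exact le_max_of_le_left (lt_add_one |φ s|).le

namespace PiecewiseAlmostPeriodic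

variable {t : ℤ → ℝ} {φ : ℝ → ℝ}

/-- A shift shorter than the distance to every impulse time stays in the same interval of
continuity. -/
theorem exists_small_shift (hφ : PiecewiseAlmostPeriodic t φ) (ht : IsTimeSequence t) {ε : ℝ}
    (hε : 0 < ε) : ∃ δ > 0, ∀ s d, |d| < δ → (∀ k, |d| < |s - t k|) → |φ (s + d) - φ s| < ε := by
  obtain ⟨δ, hδ, h⟩ := hφ.uniform_continuity ε hε
  refine ⟨δ, hδ, fun s d hd hs => ?_⟩
  obtain ⟨h1, h2⟩ := ht.firstIndex_eq_iff.1 (rfl : firstIndex t s = _)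
  set k := firstIndex t s
  have h3 := hs (k - 1)
  have h4 := hs k
  rw [abs_of_pos (sub_pos.2 h1)] at h3
  rw [abs_of_nonpos (sub_nonpos.2 h2)] at h4
  have h5 := neg_abs_le d
  have h6 := le_abs_self d
  refine h (k - 1) _ ⟨by linarith, ?_⟩ s ⟨h1, ?_⟩ (by simpa using hd) <;>
    rw [sub_add_cancel] <;> linarith

theorem bounded (hφ : PiecewiseAlmostPeriodic t φ) (ht : IsTimeSequence t) {η : ℝ}
    (hη : 0 < η) (h : ∀ k, η ≤ t (k + 1) - t k) : ∃ B > 0, ∀ s, |φ s| ≤ B := by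
  obtain ⟨δ, hδ, hu⟩ := hφ.uniform_continuity 1 one_pos
  -- η / 8 leaves room for points at distance 2ρ from both ends of each interval; δ / 4 lets every s
  -- move to such a point at a cost of at most 1 in φ. From there an almost period leads into [0,
  -- l].
  set ρ := min 1 (min (η / 8) (δ / 4)) with hρ
  have hρ0 : 0 < ρ := by positivity
  have hρ1 : ρ ≤ 1 := min_le_left _ _
  have hρ2 : ρ ≤ η / 8 := (min_le_right _ _).trans (min_le_left _ _)
  have hρ3 : ρ ≤ δ / 4 := (min_le_right _ _).trans (min_le_right _ _)
  obtain ⟨l, hl⟩ := hφ.almost_periods ρ hρ0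
  obtain ⟨B, hB⟩ := hφ.isPLC.bounded_on_compact (isCompact_Icc (a := (0 : ℝ)) (b := l))
  have key : ∀ s, |φ s| ≤ B + 2 := by
    intro s
    obtain ⟨h1, h2⟩ := ht.firstIndex_eq_iff.1 (rfl : firstIndex t s = _)
    set k := firstIndex t s
    have hk := h (k - 1)
    rw [sub_add_cancel] at hk
    obtain ⟨s', h3, h4, h5⟩ : ∃ s', t (k - 1) + 2 * ρ ≤ s' ∧ s' ≤ t k - 2 * ρ ∧
        |s - s'| < δ := by
      rcases le_or_gt s (t (k - 1) + 2 * ρ) with h6 | h6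
      · exact ⟨_, le_rfl, by linarith, by rw [abs_lt]; constructor <;> linarith⟩
      · rcases le_or_gt s (t k - 2 * ρ) with h7 | h7
        · exact ⟨s, h6.le, h7, by simpa using hδ⟩
        · exact ⟨t k - 2 * ρ, by linarith, le_rfl, by rw [abs_lt]; constructor <;> linarith⟩
    have h6 := hu (k - 1) s ⟨h1, by rwa [sub_add_cancel]⟩ s'
      ⟨by linarith, by rw [sub_add_cancel]; linarith⟩ h5
    obtain ⟨ω, hω, hωI⟩ := hl (-s')
    have h7 := hω s' fun j => by
      rcases le_or_gt j (k - 1) with hj | hj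
      · have := ht.strictMono.monotone hj
        exact (by linarith : ρ < s' - t j).trans_le (le_abs_self _)
      · have := ht.strictMono.monotone (show k ≤ j by omega)
        exact (by linarith : ρ < -(s' - t j)).trans_le (neg_le_abs _)
    have h8 := hB (s' + ω) ⟨by linarith [hωI.1], by linarith [hωI.2]⟩
    rw [abs_lt] at h6 h7
    rw [abs_le] at *
    constructor <;> linarith [h6.1, h6.2, h7.1, h7.2, h8.1, h8.2]
  exact ⟨|B + 2| + 1, by positivity, fun s => (key s).trans ((le_abs_self _).trans (by simp))⟩

theorem inMeasure (hφ : PiecewiseAlmostPeriodic t φ) (ht : IsTimeSequence t) {η : ℝ}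
    (hη : 0 < η) (h : ∀ k, η ≤ t (k + 1) - t k) : AlmostPeriodicInMeasure φ := by
  intro R hR ε hε
  obtain ⟨ρ, hρ0, hρ⟩ := ht.exists_volume_nhds_le hη h hR (half_pos hε)
  obtain ⟨δ, hδ, hd⟩ := hφ.exists_small_shift ht (ε := ε / 3) (by positivity)
  refine (hφ.almost_periods (min ρ (ε / 3)) (by positivity)).mem_almostPeriodFilter_real
    (δ := min ρ δ) (by positivity) fun p hp p' hp' d hdδ x => ?_
  have h1 := hρ _ (hdδ.le.trans (min_le_left _ _)) x
  -- Both almost periods are applied at the single point s + d - p', so only its distance to the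
  -- impulse times has to be controlled.
  have h2 := (volume_setOf_add_le (R := R) (fun y => ∃ k, |y - t k| ≤ min ρ (ε / 3)) x
    (d - p')).trans (hρ _ (min_le_left _ _) _)
  refine volume_setOf_or_le (half_pos hε).le (half_pos hε).le (add_halves ε).le h1 h2 ?_
  intro s hs
  by_contra! hc
  have h3 := hd s d (hdδ.trans_le (min_le_right _ _)) hc.1
  have h4 := (hp' _ hc.2).trans_le (min_le_right _ _)
  have h5 := (hp _ hc.2).trans_le (min_le_right _ _)
  rw [show s + (d - p') + p' = s + d by ring] at h4
  rw [show s + (d - p') + p = s + (p - p' + d) by ring] at h5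
  refine hs.not_gt ?_
  rw [abs_lt] at *
  constructor <;> linarith [h3.1, h3.2, h4.1, h4.2, h5.1, h5.2]

theorem inMeasure_delay (hφ : PiecewiseAlmostPeriodic t φ) (ht : IsTimeSequence t) {η : ℝ}
    (hη : 0 < η) (h : ∀ k, η ≤ t (k + 1) - t k) {τ : ℝ → ℝ} (hτ : Model.AdmissibleDelay τ) :
    AlmostPeriodicInMeasure fun s => φ (s - τ s) := by
  intro R hR ε hε
  obtain ⟨hτB, hτd, ⟨C, hC⟩, κ, hκ, hτκ⟩ := hτ
  have hC0 : 0 ≤ C := (abs_nonneg _).trans (hC 0)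
  have hθd : Differentiable ℝ fun s => s - τ s := differentiable_id.sub hτd
  have hderiv : ∀ s, deriv (fun s => s - τ s) s = 1 - deriv τ s := fun s =>
    ((hasDerivAt_id s).sub (hτd s).hasDerivAt).deriv
  have hlo : ∀ s s', s ≤ s' → κ * (s' - s) ≤ (s' - τ s') - (s - τ s) := fun s s' hs =>
    mul_sub_le_image_sub_of_le_deriv hθd (fun s => by rw [hderiv]; exact hτκ s) hs
  have hhi : ∀ s s', s ≤ s' → (s' - τ s') - (s - τ s) ≤ (1 + C) * (s' - s) := fun s s' hs =>
    image_sub_le_mul_sub_of_deriv_le hθd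
      (fun s => by rw [hderiv]; linarith [(abs_le.1 (hC s)).1]) hs
  -- Pulling back along s ↦ s - τ s may enlarge measure by the factor κ⁻¹.
  set ε' := min (ε / 2) (κ * (ε / 2)) with hε'
  have hε'0 : 0 < ε' := by positivity
  have hR' : 0 < (1 + C) * R := by positivity
  obtain ⟨ρ, hρ0, hρ⟩ := ht.exists_volume_nhds_le hη h hR' hε'0
  obtain ⟨δ, hδ, hd⟩ := hφ.exists_small_shift ht (ε := ε / 2) (by positivity)
  have hscale : ∀ p : ℝ → Prop, ∀ x,
      volume {y ∈ Icc (x - τ x) (x - τ x + (1 + C) * R) | p y} ≤ ENNReal.ofReal ε' →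
      volume {s ∈ Icc x (x + R) | p (s - τ s)} ≤ ENNReal.ofReal (ε / 2) := by
    intro p x hp
    refine (volume_setOf_comp_le hκ hlo hhi (by positivity) p x).trans ?_
    refine (mul_le_mul_right hp _).trans ?_
    rw [← ENNReal.ofReal_mul (by positivity)]
    refine ENNReal.ofReal_le_ofReal ?_
    rw [inv_mul_eq_div, div_le_iff₀ hκ, mul_comm]
    exact min_le_right _ _
  filter_upwards [hφ.inMeasure ht hη h _ hR' ε' hε'0,
    hτB.eventually (ε := min ρ δ) (by positivity)] with ω h1 h2 x
  have h3 := hscale _ x (h1 (x - τ x))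
  have h4 := hscale (fun y => ∃ k, |y + ω - t k| ≤ ρ) x
    ((volume_setOf_add_le (fun y => ∃ k, |y - t k| ≤ ρ) (x - τ x) ω).trans (hρ _ le_rfl _))
  refine volume_setOf_or_le (half_pos hε).le (half_pos hε).le (add_halves ε).le h3 h4 ?_
  intro s hs
  by_contra! hc
  have h5 := h2 s
  rw [abs_sub_comm] at h5
  -- The delay changes slightly under ω. This shifts the argument of φ harmlessly unless s - τ s + ω
  -- is close to an impulse time.
  have h6 := hd (s - τ s + ω) (τ s - τ (s + ω)) (h5.trans_le (min_le_right _ _))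
    fun k => (h5.trans_le (min_le_left _ _)).trans (hc.2 k)
  rw [show s - τ s + ω + (τ s - τ (s + ω)) = s + ω - τ (s + ω) by ring] at h6
  have h7 := hc.1.trans_le (min_le_left _ _)
  refine hs.not_gt ?_
  rw [abs_lt] at *
  constructor <;> linarith [h6.1, h6.2, h7.1, h7.2]

end PiecewiseAlmostPeriodic

/-! ### Elementary estimates -/

theorem prod_Ico_mul_prod_Ico (f : ℤ → ℝ) {n k l : ℤ} (hnk : n ≤ k) (hkl : k ≤ l) :
    (∏ i ∈ Finset.Ico n k, f i) * ∏ i ∈ Finset.Ico k l, f i = ∏ i ∈ Finset.Ico n l, f i := by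
  rw [← Finset.Ico_union_Ico_eq_Ico hnk hkl,
    Finset.prod_union (Finset.Ico_disjoint_Ico_consecutive _ _ _)]

/-- Pass from one product to the other through hybrids with x up to j and y from j on; exchanging
one factor costs C ε C. -/
theorem abs_prod_Ico_sub_le {x y : ℤ → ℝ} {C ε : ℝ}
    (hx : ∀ n k, |∏ i ∈ Finset.Ico n k, x i| ≤ C) (hy : ∀ n k, |∏ i ∈ Finset.Ico n k, y i| ≤ C)
    (h : ∀ i, |x i - y i| ≤ ε) {n k : ℤ} (hnk : n ≤ k) :
    |∏ i ∈ Finset.Ico n k, x i - ∏ i ∈ Finset.Ico n k, y i| ≤ (k - n) * (C * ε * C) := by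
  have hC : 0 ≤ C := (abs_nonneg _).trans (hx 0 0)
  have hε : 0 ≤ ε := (abs_nonneg _).trans (h 0)
  have key : ∀ j, n ≤ j → j ≤ k →
      |(∏ i ∈ Finset.Ico n j, x i) * (∏ i ∈ Finset.Ico j k, y i) - ∏ i ∈ Finset.Ico n k, y i| ≤
        (j - n) * (C * ε * C) := by
    intro j hj
    induction j, hj using Int.leInduction with
    | base => simp
    | succ j hj ih =>
      intro hjk
      have hs : ∀ i : ℤ, Finset.Ico i (i + 1) = {i} := fun i => by ext; simp; omega
      have h1 := ih (by omega)
      have h2 := prod_Ico_mul_prod_Ico x hj (show j ≤ j + 1 by omega)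
      have h3 := prod_Ico_mul_prod_Ico y (show j ≤ j + 1 by omega) hjk
      rw [hs, Finset.prod_singleton] at h2 h3
      rw [← h3] at h1
      rw [← h2]
      have h4 : |(∏ i ∈ Finset.Ico n j, x i) * (x j - y j) * ∏ i ∈ Finset.Ico (j + 1) k, y i| ≤
          C * ε * C := by
        rw [abs_mul, abs_mul]
        gcongr
        exacts [hx _ _, h j, hy _ _]
      push_cast
      rw [abs_le] at *
      constructor <;> linarith [h1.1, h1.2, h4.1, h4.2]
  simpa using key k hnk le_rfl

theorem abs_exp_neg_sub_exp_neg_le {x y c : ℝ} (hx : c ≤ x) (hy : c ≤ y) :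
    |Real.exp (-x) - Real.exp (-y)| ≤ Real.exp (-c) * |x - y| := by
  wlog hxy : x ≤ y generalizing x y
  · rw [abs_sub_comm, abs_sub_comm x]
    exact this hy hx (le_of_not_ge hxy)
  have h1 : Real.exp (-y) ≤ Real.exp (-x) := Real.exp_le_exp.2 (by linarith)
  rw [abs_of_nonneg (sub_nonneg.2 h1), abs_sub_comm, abs_of_nonneg (sub_nonneg.2 hxy)]
  have h2 : Real.exp (-y) = Real.exp (-x) * Real.exp (x - y) := by
    rw [← Real.exp_add]; congr 1; ring
  have h3 := Real.add_one_le_exp (x - y)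
  calc Real.exp (-x) - Real.exp (-y) = Real.exp (-x) * (1 - Real.exp (x - y)) := by rw [h2]; ring
    _ ≤ Real.exp (-x) * (y - x) :=
        mul_le_mul_of_nonneg_left (by linarith) (Real.exp_pos _).le
    _ ≤ Real.exp (-c) * (y - x) := by gcongr

/-- Half of the decay rate absorbs a linear factor; this is why the lower bound for a is written as
2c in `LinearBounds`. -/
theorem one_add_mul_exp_le {c x : ℝ} (hc : 0 < c) (hx : 0 ≤ x) :
    (1 + x) * Real.exp (-(2 * c * x)) ≤ (1 + 1 / c) * Real.exp (-(c * x)) := by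
  have h1 : 1 + x ≤ (1 + 1 / c) * Real.exp (c * x) := by
    have h2 := Real.add_one_le_exp (c * x)
    have h3 : 0 ≤ c * x := by positivity
    have h4 : x ≤ 1 / c * Real.exp (c * x) := by
      rw [one_div, inv_mul_eq_div, le_div_iff₀ hc]
      linarith
    linarith
  calc _ ≤ (1 + 1 / c) * Real.exp (c * x) * Real.exp (-(2 * c * x)) := by gcongr
    _ = _ := by rw [mul_assoc, ← Real.exp_add]; congr 2; ring

theorem integrableOn_exp_decay {c : ℝ} (hc : 0 < c) (u w : ℝ) :
    IntegrableOn (fun s => Real.exp (-(c * (u - s)))) (Iic w) := by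
  have := (integrableOn_exp_mul_Iic hc w).const_mul (Real.exp (-(c * u)))
  refine this.congr (.of_forall fun s => ?_)
  simp only
  rw [← Real.exp_add]
  congr 1
  ring

theorem integral_exp_decay {c : ℝ} (hc : 0 < c) (u w : ℝ) :
    ∫ s in Iic w, Real.exp (-(c * (u - s))) = Real.exp (-(c * (u - w))) / c := by
  have h : ∀ s, Real.exp (-(c * (u - s))) = Real.exp (-(c * u)) * Real.exp (c * s) := fun s => by
    rw [← Real.exp_add]; congr 1; ring
  simp only [h]
  rw [integral_const_mul, integral_exp_mul_Iic hc, mul_div_assoc]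

/-- An exponentially decaying integrand that is small off a set of small measure has a small
integral. -/
theorem abs_setIntegral_le_of_small_off {D : ℝ → ℝ} {E : Set ℝ} {K c ε ρ R u : ℝ} (hK : 0 ≤ K)
    (hc : 0 < c) (hε : 0 ≤ ε) (hρ : 0 ≤ ρ) (hD : ∀ s ≤ u, |D s| ≤ K * Real.exp (-(c * (u - s))))
    (hDE : ∀ s ≤ u, s ∉ E → |D s| ≤ ε * (K * Real.exp (-(c * (u - s)))))
    (hE : volume {s ∈ Icc (u - R) (u - R + R) | s ∈ E} ≤ ENNReal.ofReal ρ) :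
    |∫ s in Iic u, D s| ≤ K * (ε / c + Real.exp (-(c * R)) / c + ρ) := by
  -- E is not assumed measurable, so the exceptional part of the window is replaced by a measurable
  -- hull.
  set E' := toMeasurable volume {s ∈ Icc (u - R) (u - R + R) | s ∈ E} with hE'
  have hE'm : MeasurableSet E' := measurableSet_toMeasurable _ _
  have hE'v : volume E' ≤ ENNReal.ofReal ρ := by rwa [hE', measure_toMeasurable]
  have hE'v' : volume.restrict (Iic u) E' ≤ ENNReal.ofReal ρ :=
    (Measure.restrict_apply_le _ _).trans hE'v
  set e := fun s => Real.exp (-(c * (u - s))) with he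
  have hle : ∀ s ∈ Iic u, ‖D s‖ ≤
      K * (ε * e s + (Iic (u - R)).indicator e s + E'.indicator (fun _ => 1) s) := by
    intro s hs
    rw [Real.norm_eq_abs]
    have he0 : 0 < e s := Real.exp_pos _
    have he1 : e s ≤ 1 := Real.exp_le_one_iff.2
      (neg_nonpos.2 (mul_nonneg hc.le (sub_nonneg.2 hs)))
    have h1 : 0 ≤ (Iic (u - R)).indicator e s := indicator_nonneg (fun _ _ => (Real.exp_pos _).le) _
    have h2 : 0 ≤ E'.indicator (fun _ => (1 : ℝ)) s := indicator_nonneg (fun _ _ => zero_le_one) _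
    have h0 : 0 ≤ ε * e s := by positivity
    by_cases hsE : s ∈ E
    · refine (hD s hs).trans ?_
      refine mul_le_mul_of_nonneg_left ?_ hK
      rcases le_or_gt s (u - R) with h3 | h3
      · rw [indicator_of_mem (show s ∈ Iic (u - R) from h3)]
        change e s ≤ _
        linarith
      · have h4 : s ∈ E' := subset_toMeasurable _ _
          ⟨⟨h3.le, by rw [sub_add_cancel]; exact hs⟩, hsE⟩
        rw [indicator_of_mem h4]
        change e s ≤ _
        linarith
    · refine (hDE s hs hsE).trans ?_
      rw [mul_left_comm]
      refine mul_le_mul_of_nonneg_left ?_ hK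
      change ε * e s ≤ _
      linarith
  have hi1 : Integrable (fun s => ε * e s) (volume.restrict (Iic u)) :=
    (integrableOn_exp_decay hc u u).const_mul ε
  have hi2 : Integrable ((Iic (u - R)).indicator e) (volume.restrict (Iic u)) :=
    (integrableOn_exp_decay hc u u).indicator measurableSet_Iic
  have hi3 : Integrable (E'.indicator fun _ => (1 : ℝ)) (volume.restrict (Iic u)) :=
    (integrable_indicator_iff hE'm).2
      (integrableOn_const (hE'v'.trans_lt ENNReal.ofReal_lt_top).ne)
  have hi12 : Integrable (fun s => ε * e s + (Iic (u - R)).indicator e s)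
    (volume.restrict (Iic u)) := hi1.add hi2
  have h2 : ∫ s in Iic u, (Iic (u - R)).indicator e s ≤ Real.exp (-(c * R)) / c := by
    rw [setIntegral_indicator measurableSet_Iic]
    calc _ ≤ ∫ s in Iic (u - R), e s :=
          setIntegral_mono_set (integrableOn_exp_decay hc u (u - R))
            (.of_forall fun _ => (Real.exp_pos _).le) (.of_forall inter_subset_right)
      _ = _ := by rw [he, integral_exp_decay hc, sub_sub_cancel]
  have h3 : ∫ s in Iic u, E'.indicator (fun _ => (1 : ℝ)) s ≤ ρ := by
    rw [integral_indicator hE'm, setIntegral_const, smul_eq_mul, mul_one]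
    exact ENNReal.toReal_le_of_le_ofReal hρ hE'v'
  calc |∫ s in Iic u, D s|
      ≤ ∫ s in Iic u, K * (ε * e s + (Iic (u - R)).indicator e s + E'.indicator (fun _ => 1) s) :=
        norm_integral_le_of_norm_le ((hi12.add hi3).const_mul K)
          ((ae_restrict_iff' measurableSet_Iic).2 (.of_forall hle))
    _ = K * (ε * (1 / c) + (∫ s in Iic u, (Iic (u - R)).indicator e s)
          + ∫ s in Iic u, E'.indicator (fun _ => 1) s) := by
        rw [integral_const_mul, integral_add hi12 hi3, integral_add hi1 hi2,
          integral_const_mul, he, integral_exp_decay hc]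
        simp
    _ ≤ K * (ε / c + Real.exp (-(c * R)) / c + ρ) := by
        rw [mul_one_div]
        gcongr

namespace Model

variable {m : ℕ} {M : Model m}

/-! ### The Cauchy matrix -/

theorem isTimeSequence (M : Model m) : IsTimeSequence M.t :=
  ⟨M.t_strictMono, M.t_atTop, M.t_atBot⟩

theorem cauchy_eq (M : Model m) (u s : ℝ) :
    M.cauchy u s = (∏ i ∈ Finset.Ico (firstIndex M.t s) (firstIndex M.t u), (1 + M.γ i)) *
      Real.exp (-∫ r in s..u, M.a r) := by
  have h : {i : ℤ | s ≤ M.t i ∧ M.t i < u} =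
      (Finset.Ico (firstIndex M.t s) (firstIndex M.t u) : Finset ℤ) := by
    ext i
    rw [Finset.coe_Ico, mem_Ico, M.isTimeSequence.firstIndex_le_iff,
      M.isTimeSequence.lt_firstIndex_iff, mem_ofPred_eq]
  rw [cauchy, h, finprod_mem_coe_finset]

/-- The bounds that follow from the assumptions on the linear impulsive equation. -/
structure LinearBounds (M : Model m) (c A C D η : ℝ) : Prop where
  continuous : Continuous M.a
  c_pos : 0 < c
  le_a : ∀ s, 2 * c ≤ M.a s
  a_le : ∀ s, |M.a s| ≤ A
  γ_pos : ∀ k, 0 < 1 + M.γ k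
  one_le : 1 ≤ C
  prod_le : ∀ n k, ∏ i ∈ Finset.Ico n k, (1 + M.γ i) ≤ C
  D_pos : 0 < D
  δ_le : ∀ k, |M.δ k| ≤ D
  η_pos : 0 < η
  gap : ∀ k, η ≤ M.t (k + 1) - M.t k

theorem exists_linearBounds (hA1 : M.DecayAssumption) (hA5 : AlmostPeriodicSeq M.δ)
    (hA6 : M.JumpFactorAssumption) (hA7 : M.ImpulseTimeAssumption) :
    ∃ c A C D η, M.LinearBounds c A C D η := by
  obtain ⟨ha, a₀, ha₀, hle⟩ := hA1
  obtain ⟨A, _, hA⟩ := ha.bounded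
  obtain ⟨D, hD0, hD⟩ := hA5.bounded
  obtain ⟨_, ⟨g, hg, hγ⟩, ⟨C, hC⟩, _⟩ := hA6
  obtain ⟨_, η, hη, hgap⟩ := hA7
  refine ⟨a₀ / 2, A, max C 1, D, η, ha.1, by positivity, fun s => ?_, hA, fun k => ?_,
    le_max_right _ _, fun n k => ?_, hD0, hD, hη, hgap⟩
  · linarith [hle s]
  · linarith [hγ k]
  · rcases le_or_gt k n with h | h
    · simp [Finset.Ico_eq_empty_of_le h]
    · have h1 := hC n (k - 1) (by omega)
      rw [Gam, show Finset.Icc n (k - 1) = Finset.Ico n k by ext; simp] at h1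
      exact h1.trans (le_max_left _ _)

namespace LinearBounds

variable {c A C D η : ℝ}

theorem prod_pos (hM : M.LinearBounds c A C D η) (n k : ℤ) :
    0 < ∏ i ∈ Finset.Ico n k, (1 + M.γ i) := Finset.prod_pos fun i _ => hM.γ_pos i

theorem intervalIntegrable (hM : M.LinearBounds c A C D η) (s u : ℝ) :
    IntervalIntegrable M.a volume s u := hM.continuous.intervalIntegrable _ _

theorem le_integral (hM : M.LinearBounds c A C D η) {s u : ℝ} (h : s ≤ u) :
    2 * c * (u - s) ≤ ∫ r in s..u, M.a r := by
  have h1 := intervalIntegral.integral_mono_on h (intervalIntegrable_const (c := 2 * c))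
    (hM.intervalIntegrable s u) fun r _ => hM.le_a r
  rw [intervalIntegral.integral_const, smul_eq_mul] at h1
  linarith

theorem abs_integral_le (hM : M.LinearBounds c A C D η) (s u : ℝ) :
    |∫ r in s..u, M.a r| ≤ A * |u - s| := by
  rw [← Real.norm_eq_abs]
  exact intervalIntegral.norm_integral_le_of_norm_le_const fun r _ => hM.a_le r

theorem A_nonneg (hM : M.LinearBounds c A C D η) : 0 ≤ A := (abs_nonneg _).trans (hM.a_le 0)

theorem C_pos (hM : M.LinearBounds c A C D η) : 0 < C := one_pos.trans_le hM.one_le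

theorem cauchy_nonneg (hM : M.LinearBounds c A C D η) (u s : ℝ) : 0 ≤ M.cauchy u s := by
  rw [cauchy_eq]
  exact mul_nonneg (hM.prod_pos _ _).le (Real.exp_pos _).le

theorem cauchy_le_two_mul (hM : M.LinearBounds c A C D η) {u s : ℝ} (h : s ≤ u) :
    M.cauchy u s ≤ C * Real.exp (-(2 * c * (u - s))) := by
  rw [cauchy_eq]
  have h1 := hM.le_integral h
  have h2 := hM.prod_le (firstIndex M.t s) (firstIndex M.t u)
  have h3 := hM.C_pos
  gcongr

theorem cauchy_le (hM : M.LinearBounds c A C D η) {u s : ℝ} (h : s ≤ u) :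
    M.cauchy u s ≤ C * Real.exp (-(c * (u - s))) := by
  refine (hM.cauchy_le_two_mul h).trans ?_
  have h3 := hM.C_pos
  have h4 := mul_nonneg hM.c_pos.le (sub_nonneg.2 h)
  gcongr ?_ * Real.exp ?_
  linarith

theorem cauchy_mul (hM : M.LinearBounds c A C D η) {s u w : ℝ} (hsu : s ≤ u) (huw : u ≤ w) :
    M.cauchy w s = M.cauchy w u * M.cauchy u s := by
  rw [cauchy_eq, cauchy_eq, cauchy_eq, ← prod_Ico_mul_prod_Ico _
    (M.isTimeSequence.firstIndex_mono hsu) (M.isTimeSequence.firstIndex_mono huw),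
    ← intervalIntegral.integral_add_adjacent_intervals (hM.intervalIntegrable s u)
      (hM.intervalIntegrable u w), neg_add, Real.exp_add]
  ring

theorem measurable_cauchy (hM : M.LinearBounds c A C D η) (u : ℝ) :
    Measurable fun s => M.cauchy u s := by
  simp only [cauchy_eq]
  refine Measurable.mul ?_ ?_
  · exact (measurable_of_countable fun n =>
      ∏ i ∈ Finset.Ico n (firstIndex M.t u), (1 + M.γ i)).comp
      M.isTimeSequence.firstIndex_mono.measurable
  · refine (Real.continuous_exp.comp (Continuous.neg ?_)).measurable
    simp only [intervalIntegral.integral_symm u]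
    exact (intervalIntegral.continuous_primitive hM.intervalIntegrable u).neg

/-- The Cauchy matrix is almost periodic: it changes little under a common almost period of the
coefficients and the times. -/
theorem exists_abs_cauchy_sub_le (hM : M.LinearBounds c A C D η) :
    ∃ K > 0, ∀ ε, 0 ≤ ε → ε ≤ 1 → ∀ (ω : ℝ) (q : ℤ), (∀ s, |M.a (s + ω) - M.a s| ≤ ε) →
      (∀ k, |M.γ (k + q) - M.γ k| ≤ ε) → ∀ u s s', s ≤ u → s' ≤ u + ω → |s' - (s + ω)| ≤ ε →
      firstIndex M.t (u + ω) = firstIndex M.t u + q →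
      firstIndex M.t s' = firstIndex M.t s + q →
      |M.cauchy (u + ω) s' - M.cauchy u s| ≤ ε * (K * Real.exp (-(c * (u - s)))) := by
  have hC := hM.C_pos
  have hA := hM.A_nonneg
  have hη := hM.η_pos
  have hc := hM.c_pos
  -- The first term comes from the product, with at most (u - s) / η + 1 factors; the second from
  -- the exponentials of the integrals of a.
  set K₀ := C * C * (1 / η + 1) + C * Real.exp (2 * c) * (1 + A) with hK₀
  refine ⟨K₀ * (1 + 1 / c), by positivity, ?_⟩
  intro ε hε hε1 ω q ha hγ u s s' hsu hsu' hss' hu hs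
  have hx : 0 ≤ u - s := sub_nonneg.2 hsu
  set n := firstIndex M.t s with hn
  set k := firstIndex M.t u with hk
  have hnk : n ≤ k := M.isTimeSequence.firstIndex_mono hsu
  have hcard := M.isTimeSequence.firstIndex_sub_le hη hM.gap hsu
  rw [← hk, ← hn] at hcard
  push_cast at hcard
  -- the integrals of `a`
  have hint : |(∫ r in s'..u + ω, M.a r) - ∫ r in s..u, M.a r| ≤ ε * (u - s) + A * ε := by
    have h1 : (∫ r in s'..u + ω, M.a r) =
        (∫ r in s'..s + ω, M.a r) + ∫ r in s..u, M.a (r + ω) := by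
      rw [intervalIntegral.integral_comp_add_right,
        intervalIntegral.integral_add_adjacent_intervals (hM.intervalIntegrable _ _)
          (hM.intervalIntegrable _ _)]
    have h2 : (∫ r in s..u, M.a (r + ω)) - ∫ r in s..u, M.a r =
        ∫ r in s..u, (M.a (r + ω) - M.a r) := by
      rw [intervalIntegral.integral_sub _ (hM.intervalIntegrable _ _)]
      exact (hM.continuous.comp (continuous_add_const ω)).intervalIntegrable _ _
    have h3 : |∫ r in s..u, (M.a (r + ω) - M.a r)| ≤ ε * |u - s| := by
      rw [← Real.norm_eq_abs]
      exact intervalIntegral.norm_integral_le_of_norm_le_const fun r _ => ha r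
    rw [abs_of_nonneg hx] at h3
    have h4 := hM.abs_integral_le s' (s + ω)
    rw [abs_sub_comm] at h4
    have h5 : A * |s' - (s + ω)| ≤ A * ε := by gcongr
    rw [h1, add_sub_assoc, h2]
    refine (abs_add_le _ _).trans ?_
    linarith
  have hexp : |Real.exp (-∫ r in s'..u + ω, M.a r) - Real.exp (-∫ r in s..u, M.a r)| ≤
      Real.exp (2 * c) * Real.exp (-(2 * c * (u - s))) * (ε * (u - s) + A * ε) := by
    have h1 := hM.le_integral hsu
    have h2 := hM.le_integral hsu'
    have h3 := (abs_le.1 hss').2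
    -- Since s' exceeds s + ω by at most ε ≤ 1, the shifted interval is at most 1 shorter than u -
    -- s; this loses the factor exp(2c).
    refine (abs_exp_neg_sub_exp_neg_le (c := 2 * c * (u - s) - 2 * c) ?_ ?_).trans ?_
    · nlinarith
    · linarith
    · rw [neg_sub, sub_eq_add_neg, Real.exp_add]
      gcongr
  have hprod : |∏ i ∈ Finset.Ico (n + q) (k + q), (1 + M.γ i) -
      ∏ i ∈ Finset.Ico n k, (1 + M.γ i)| ≤ (k - n) * (C * ε * C) := by
    have h1 : ∀ n k, ∏ i ∈ Finset.Ico (n + q) (k + q), (1 + M.γ i) =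
        ∏ i ∈ Finset.Ico n k, (1 + M.γ (i + q)) := fun n k => by
      rw [← Finset.image_add_right_Ico, Finset.prod_image fun _ _ _ _ h => add_right_cancel h]
    rw [h1]
    refine abs_prod_Ico_sub_le (fun n k => ?_) (fun n k => ?_) (fun i => ?_) hnk
    · rw [← h1, abs_of_pos (hM.prod_pos _ _)]
      exact hM.prod_le _ _
    · rw [abs_of_pos (hM.prod_pos _ _)]
      exact hM.prod_le _ _
    · simpa using hγ i
  have hE : Real.exp (-∫ r in s..u, M.a r) ≤ Real.exp (-(2 * c * (u - s))) :=
    Real.exp_le_exp.2 (neg_le_neg (hM.le_integral hsu))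
  rw [cauchy_eq, cauchy_eq, hu, hs]
  set P' := ∏ i ∈ Finset.Ico (n + q) (k + q), (1 + M.γ i) with hP'
  set P := ∏ i ∈ Finset.Ico n k, (1 + M.γ i)
  set E' := Real.exp (-∫ r in s'..u + ω, M.a r)
  set E := Real.exp (-∫ r in s..u, M.a r)
  have hP'C : |P'| ≤ C := by
    rw [abs_of_pos (hM.prod_pos _ _)]
    exact hM.prod_le _ _
  have hE0 : 0 ≤ E := (Real.exp_pos _).le
  set x := u - s
  set e := Real.exp (-(2 * c * x)) with he
  have he0 : 0 < e := Real.exp_pos _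
  calc |P' * E' - P * E| = |P' * (E' - E) + (P' - P) * E| := by ring_nf
    _ ≤ |P'| * |E' - E| + |P' - P| * E := by
        refine (abs_add_le _ _).trans ?_
        rw [abs_mul, abs_mul, abs_of_nonneg hE0]
    _ ≤ C * (Real.exp (2 * c) * e * (ε * x + A * ε)) + (x / η + 1) * (C * ε * C) * e := by
        gcongr
        refine hprod.trans ?_
        gcongr
    _ = ε * ((C * C * (x / η + 1) + C * Real.exp (2 * c) * (x + A)) * e) := by ring
    _ ≤ ε * (K₀ * (1 + x) * e) := by
        gcongr
        rw [hK₀, add_mul, mul_assoc (C * C), mul_assoc (C * Real.exp (2 * c))]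
        have h1 : 0 ≤ 1 / η := by positivity
        gcongr
        · rw [div_eq_mul_one_div]
          nlinarith
        · nlinarith
    _ = ε * (K₀ * ((1 + x) * e)) := by ring
    _ ≤ ε * (K₀ * ((1 + 1 / c) * Real.exp (-(c * x)))) := by
        have := one_add_mul_exp_le hc hx
        gcongr ε * (K₀ * ?_)
    _ = _ := by ring

end LinearBounds

end Model

namespace Model

variable {m : ℕ} {M : Model m}

/-! ### The bounded solution of the linear impulsive equation -/

/-- The response of the linear impulsive equation to the inhomogeneity `N` and the jumps `δ`. -/
def response (M : Model m) (N : ℝ → ℝ) (u : ℝ) : ℝ :=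
  (∫ s in Iic u, M.cauchy u s * N s) + ∑' k : {k : ℤ // M.t k < u}, M.cauchy u (M.t k) * M.δ k

/-- The impulse times before `u`, listed backwards. -/
def timesBeforeEquiv (M : Model m) (u : ℝ) : ℕ ≃ {k : ℤ // M.t k < u} where
  toFun j := ⟨firstIndex M.t u - 1 - j, M.isTimeSequence.lt_firstIndex_iff.1 (by omega)⟩
  invFun k := (firstIndex M.t u - 1 - k.1).toNat
  left_inv j := by simp
  right_inv k := by
    have := M.isTimeSequence.lt_firstIndex_iff.2 k.2
    ext
    simp only
    omega

/-- Counting backwards from the last impulse gives series at different times a common index set, so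
they can be compared term by term. -/
theorem tsum_timesBefore (M : Model m) (u w : ℝ) (h : firstIndex M.t w = firstIndex M.t u) :
    ∑' k : {k : ℤ // M.t k < w}, M.cauchy w (M.t k) * M.δ k =
      ∑' j : ℕ, M.cauchy w (M.t (firstIndex M.t u - 1 - j)) * M.δ (firstIndex M.t u - 1 - j) := by
  rw [← (M.timesBeforeEquiv w).tsum_eq, ← h]
  rfl

namespace LinearBounds

variable {c A C D η : ℝ}

theorem mul_le_sub (hM : M.LinearBounds c A C D η) (u : ℝ) (j : ℕ) :
    η * j ≤ u - M.t (firstIndex M.t u - 1 - j) := by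
  have h1 := IsTimeSequence.mul_sub_le hM.gap (n := firstIndex M.t u - 1 - j)
    (k := firstIndex M.t u - 1) (by omega)
  have h2 := M.isTimeSequence.apply_lt_of_lt_firstIndex (s := u) (i := firstIndex M.t u - 1)
    (by omega)
  push_cast at h1
  rw [sub_sub_cancel] at h1
  linarith

theorem sub_apply_nonneg (hM : M.LinearBounds c A C D η) (u : ℝ) (j : ℕ) :
    0 ≤ u - M.t (firstIndex M.t u - 1 - j) :=
  (mul_nonneg hM.η_pos.le j.cast_nonneg).trans (hM.mul_le_sub u j)

theorem exp_le (hM : M.LinearBounds c A C D η) (u : ℝ) (j : ℕ) :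
    Real.exp (-(c * (u - M.t (firstIndex M.t u - 1 - j)))) ≤ Real.exp (j * (-(c * η))) := by
  refine Real.exp_le_exp.2 ?_
  have := mul_le_mul_of_nonneg_left (hM.mul_le_sub u j) hM.c_pos.le
  linarith

theorem summable_exp (hM : M.LinearBounds c A C D η) :
    Summable fun j : ℕ => Real.exp (j * (-(c * η))) :=
  Real.summable_exp_nat_mul_iff.2 (neg_lt_zero.2 (mul_pos hM.c_pos hM.η_pos))

theorem abs_cauchy_mul_δ_le (hM : M.LinearBounds c A C D η) (u : ℝ) (j : ℕ) :
    ‖M.cauchy u (M.t (firstIndex M.t u - 1 - j)) * M.δ (firstIndex M.t u - 1 - j)‖ ≤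
      C * D * Real.exp (j * (-(c * η))) := by
  have h1 := hM.cauchy_le (sub_nonneg.1 (hM.sub_apply_nonneg u j))
  have h2 := hM.exp_le u j
  have h3 := hM.δ_le (firstIndex M.t u - 1 - j)
  have h4 := hM.C_pos
  have h5 := hM.D_pos
  rw [norm_mul, Real.norm_eq_abs, Real.norm_eq_abs, abs_of_nonneg (hM.cauchy_nonneg _ _)]
  calc _ ≤ (C * Real.exp (j * (-(c * η)))) * D := by
        gcongr
        exact h1.trans (by gcongr)
    _ = _ := by ring

theorem summable_nat (hM : M.LinearBounds c A C D η) (u : ℝ) :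
    Summable fun j : ℕ =>
      M.cauchy u (M.t (firstIndex M.t u - 1 - j)) * M.δ (firstIndex M.t u - 1 - j) :=
  .of_norm_bounded (hM.summable_exp.mul_left (C * D)) (hM.abs_cauchy_mul_δ_le u)

theorem summable (hM : M.LinearBounds c A C D η) (u : ℝ) :
    Summable fun k : {k : ℤ // M.t k < u} => M.cauchy u (M.t k) * M.δ k :=
  (M.timesBeforeEquiv u).summable_iff.1 (hM.summable_nat u)

variable {N : ℝ → ℝ} {B : ℝ}

theorem abs_cauchy_mul_le (hM : M.LinearBounds c A C D η) (hB : ∀ s, |N s| ≤ B) {u s : ℝ}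
    (h : s ≤ u) : |M.cauchy u s * N s| ≤ C * B * Real.exp (-(c * (u - s))) := by
  have h1 := hM.cauchy_le h
  have h2 := hB s
  have h3 := hM.C_pos
  rw [abs_mul, abs_of_nonneg (hM.cauchy_nonneg _ _)]
  calc _ ≤ C * Real.exp (-(c * (u - s))) * B := by gcongr
    _ = _ := by ring

theorem integrableOn (hM : M.LinearBounds c A C D η) (hN : AEStronglyMeasurable N)
    (hB : ∀ s, |N s| ≤ B) (u : ℝ) : IntegrableOn (fun s => M.cauchy u s * N s) (Iic u) := by
  refine Integrable.mono' ((integrableOn_exp_decay hM.c_pos u u).const_mul (C * B))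
    ((hM.measurable_cauchy u).aestronglyMeasurable.mul hN).restrict ?_
  exact (ae_restrict_iff' measurableSet_Iic).2
    (.of_forall fun s hs => hM.abs_cauchy_mul_le hB hs)

theorem exists_abs_response_le (hM : M.LinearBounds c A C D η) (hB : ∀ s, |N s| ≤ B) :
    ∃ Q, ∀ u, |M.response N u| ≤ Q := by
  refine ⟨C * B / c + C * D * ∑' j : ℕ, Real.exp (j * (-(c * η))), fun u => ?_⟩
  refine (abs_add_le _ _).trans (add_le_add ?_ ?_)
  · have h1 := norm_integral_le_of_norm_le (f := fun s => M.cauchy u s * N s) ((integrableOn_exp_decay hM.c_pos u u).const_mul (C * B))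
      ((ae_restrict_iff' measurableSet_Iic).2
        (.of_forall fun s hs => hM.abs_cauchy_mul_le (N := N) hB hs))
    rwa [integral_const_mul, integral_exp_decay hM.c_pos, sub_self, mul_zero, neg_zero,
      Real.exp_zero, mul_one_div] at h1
  · rw [M.tsum_timesBefore u u rfl, ← tsum_mul_left]
    exact tsum_of_norm_bounded (hM.summable_exp.mul_left (C * D)).hasSum
      (hM.abs_cauchy_mul_δ_le u)

/-- Between two impulses the response solves the linear equation. -/
theorem response_eq (hM : M.LinearBounds c A C D η) (hN : AEStronglyMeasurable N)
    (hB : ∀ s, |N s| ≤ B) {u w : ℝ} (huw : u ≤ w) (h : firstIndex M.t w = firstIndex M.t u) :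
    M.response N w = M.cauchy w u * M.response N u + ∫ s in Ioc u w, M.cauchy w s * N s := by
  have h1 : ∫ s in Iic w, M.cauchy w s * N s =
      M.cauchy w u * (∫ s in Iic u, M.cauchy u s * N s) + ∫ s in Ioc u w, M.cauchy w s * N s := by
    have hI := hM.integrableOn hN hB w
    rw [← Iic_union_Ioc_eq_Iic huw, setIntegral_union
      (disjoint_left.2 fun s hs hs' => hs'.1.not_ge hs) measurableSet_Ioc
      (hI.mono_set (Iic_subset_Iic.2 huw)) (hI.mono_set Ioc_subset_Iic_self), ← integral_const_mul]
    congr 1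
    refine setIntegral_congr_fun measurableSet_Iic fun s hs => ?_
    rw [hM.cauchy_mul hs huw, mul_assoc]
  rw [response, response, h1, M.tsum_timesBefore u w h, M.tsum_timesBefore u u rfl, mul_add,
    ← tsum_mul_left]
  have h2 : ∀ j : ℕ, M.cauchy w (M.t (firstIndex M.t u - 1 - j)) * M.δ (firstIndex M.t u - 1 - j) =
      M.cauchy w u * (M.cauchy u (M.t (firstIndex M.t u - 1 - j)) *
        M.δ (firstIndex M.t u - 1 - j)) := fun j => by
    rw [hM.cauchy_mul (sub_nonneg.1 (hM.sub_apply_nonneg u j)) huw, mul_assoc]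
  simp only [h2]
  ring

/-- By `response_eq`, with no impulse in between, the old value is multiplied by a factor within A
(w - u) of 1 and an integral of size C B (w - u) is added. -/
theorem exists_lipschitz_response (hM : M.LinearBounds c A C D η) (hN : AEStronglyMeasurable N)
    (hB : ∀ s, |N s| ≤ B) : ∃ L : ℝ, 0 < L ∧ ∀ u w, firstIndex M.t w = firstIndex M.t u →
      |M.response N w - M.response N u| ≤ L * |w - u| := by
  obtain ⟨Q, hQ⟩ := hM.exists_abs_response_le hB
  have hQ0 : 0 ≤ Q := (abs_nonneg _).trans (hQ 0)
  have hB0 : 0 ≤ B := (abs_nonneg _).trans (hB 0)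
  have hA := hM.A_nonneg
  have hC := hM.C_pos
  refine ⟨A * Q + C * B + 1, by positivity, fun u w h => ?_⟩
  wlog huw : u ≤ w generalizing u w
  · rw [abs_sub_comm, abs_sub_comm w]
    exact this w u h.symm (le_of_not_ge huw)
  have hx : 0 ≤ w - u := sub_nonneg.2 huw
  rw [hM.response_eq hN hB huw h, abs_of_nonneg hx]
  have h1 : |M.cauchy w u - 1| ≤ A * (w - u) := by
    rw [cauchy_eq, h, Finset.Ico_self, Finset.prod_empty, one_mul]
    have h2 := hM.le_integral huw
    have h3 := hM.abs_integral_le u w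
    have h4 : 0 ≤ 2 * c * (w - u) := mul_nonneg (by linarith [hM.c_pos]) hx
    have h5 := abs_exp_neg_sub_exp_neg_le (h4.trans h2) le_rfl
    rw [abs_of_nonneg hx] at h3
    simp only [neg_zero, Real.exp_zero, sub_zero, one_mul] at h5
    exact h5.trans h3
  have h2 : |∫ s in Ioc u w, M.cauchy w s * N s| ≤ C * B * (w - u) := by
    have h3 := norm_setIntegral_le_of_norm_le_const (μ := volume) (s := Ioc u w) (C := C * B)
      (f := fun s => M.cauchy w s * N s) (by simp) fun s hs => by
        refine (hM.abs_cauchy_mul_le hB hs.2).trans ?_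
        refine mul_le_of_le_one_right (by positivity) (Real.exp_le_one_iff.2 ?_)
        exact neg_nonpos.2 (mul_nonneg hM.c_pos.le (sub_nonneg.2 hs.2))
    rwa [Measure.real, Real.volume_Ioc, ENNReal.toReal_ofReal hx] at h3
  calc _ = |(M.cauchy w u - 1) * M.response N u + ∫ s in Ioc u w, M.cauchy w s * N s| := by
        ring_nf
    _ ≤ A * (w - u) * Q + C * B * (w - u) := by
        refine (abs_add_le _ _).trans (add_le_add ?_ h2)
        rw [abs_mul]
        gcongr
        exact hQ u
    _ ≤ _ := by linarith

/-- The translates of the response by common almost periods. -/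
theorem abs_response_sub_le (hM : M.LinearBounds c A C D η) (hN : AEStronglyMeasurable N)
    (hB : ∀ s, |N s| ≤ B) : ∃ Q > 0, ∀ ε ρ R ξ, 0 < ξ → ξ ≤ ε → ε ≤ 1 → 0 ≤ ρ → ∀ (ω : ℝ) (q : ℤ),
      (∀ s, |M.a (s + ω) - M.a s| ≤ ε) → (∀ k, |M.γ (k + q) - M.γ k| ≤ ε) →
      (∀ k, |M.δ (k + q) - M.δ k| ≤ ε) → (∀ k, |M.t (k + q) - M.t k - ω| < ξ) →
      (∀ x, volume {s ∈ Icc x (x + R) | ε ≤ |N (s + ω) - N s| ∨ ∃ k, |s - M.t k| ≤ ξ} ≤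
        ENNReal.ofReal ρ) →
      ∀ u, (∀ k, ξ < |u - M.t k|) →
        |M.response N (u + ω) - M.response N u| ≤ Q * (ε + Real.exp (-(c * R)) + ρ) := by
  obtain ⟨K, hK, hKM⟩ := hM.exists_abs_cauchy_sub_le
  have hc := hM.c_pos
  have hC := hM.C_pos
  have hD := hM.D_pos
  have hB0 : 0 ≤ B := (abs_nonneg _).trans (hB 0)
  set S := ∑' j : ℕ, Real.exp (j * (-(c * η))) with hS
  have hS0 : 0 ≤ S := tsum_nonneg fun _ => (Real.exp_pos _).le
  set K' := 2 * (C * B) + C + K * B with hK'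
  have hK'0 : 0 < K' := by positivity
  refine ⟨K' * (1 / c + 1) + (C + K * D) * S, by positivity, ?_⟩
  intro ε ρ R ξ hξ hξε hε1 hρ ω q ha hγ hδ ht hE u hu
  have hε : 0 < ε := hξ.trans_le hξε
  have hT := M.isTimeSequence
  have hKq := hKM ε hε.le hε1 ω q ha hγ
  have huq : firstIndex M.t (u + ω) = firstIndex M.t u + q :=
    hT.firstIndex_add_eq ht fun k => (hu k).le
  have hint : |(∫ s in Iic (u + ω), M.cauchy (u + ω) s * N s) - ∫ s in Iic u, M.cauchy u s * N s| ≤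
      K' * (ε / c + Real.exp (-(c * R)) / c + ρ) := by
    have hemb := measurableEmbedding_addRight ω
    have hmp := measurePreserving_add_right volume ω
    have hpre : (fun s => s + ω) ⁻¹' Iic (u + ω) = Iic u := by ext s; simp
    have h1 := hmp.setIntegral_preimage_emb hemb (fun s => M.cauchy (u + ω) s * N s) (Iic (u + ω))
    have h2 : IntegrableOn (fun s => M.cauchy (u + ω) (s + ω) * N (s + ω))
      ((fun s => s + ω) ⁻¹' Iic (u + ω)) := (hmp.integrableOn_comp_preimage hemb).2 (hM.integrableOn hN hB (u + ω))
    rw [hpre] at h1 h2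
    rw [← h1, ← integral_sub h2 (hM.integrableOn hN hB u)]
    refine abs_setIntegral_le_of_small_off hK'0.le hc hε.le hρ
      -- Neighbourhoods of the impulse times are excluded too, since there the index of s + ω may
      -- differ from that of s by something other than q.
      (E := {s | ε ≤ |N (s + ω) - N s| ∨ ∃ k, |s - M.t k| ≤ ξ}) ?_ ?_ (hE (u - R))
    · intro s hs
      have h3 := hM.abs_cauchy_mul_le hB (add_le_add_left hs ω)
      have h4 := hM.abs_cauchy_mul_le hB hs
      rw [add_sub_add_right_eq_sub] at h3
      refine (abs_sub _ _).trans ((add_le_add h3 h4).trans ?_)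
      rw [← two_mul, ← mul_assoc]
      gcongr
      rw [hK', add_assoc]
      exact le_add_of_nonneg_right (by positivity)
    · intro s hs hsE
      simp only [mem_ofPred_eq, not_or, not_le, not_exists] at hsE
      have h3 := hKq u s (s + ω) hs (add_le_add_left hs ω) (by simpa using hε.le) huq
        (hT.firstIndex_add_eq ht fun k => (hsE.2 k).le)
      have h4 := hM.cauchy_le (add_le_add_left hs ω)
      rw [add_sub_add_right_eq_sub] at h4
      have h5 := hM.cauchy_nonneg (u + ω) (s + ω)
      have h6 := hB s
      have h7 := hsE.1.le
      set e := Real.exp (-(c * (u - s)))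
      have he : 0 < e := Real.exp_pos _
      calc |M.cauchy (u + ω) (s + ω) * N (s + ω) - M.cauchy u s * N s|
          = |M.cauchy (u + ω) (s + ω) * (N (s + ω) - N s) +
              (M.cauchy (u + ω) (s + ω) - M.cauchy u s) * N s| := by ring_nf
        _ ≤ C * e * ε + ε * (K * e) * B := by
            refine (abs_add_le _ _).trans ?_
            rw [abs_mul, abs_mul, abs_of_nonneg h5]
            gcongr
        _ = ε * ((C + K * B) * e) := by ring
        _ ≤ ε * (K' * e) := by
            gcongr
            rw [hK', add_assoc]
            exact le_add_of_nonneg_left (by positivity)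
  have hsum : |(∑' k : {k : ℤ // M.t k < u + ω}, M.cauchy (u + ω) (M.t k) * M.δ k) -
      ∑' k : {k : ℤ // M.t k < u}, M.cauchy u (M.t k) * M.δ k| ≤ ε * ((C + K * D) * S) := by
    have hs1 := hM.summable_nat (u + ω)
    rw [M.tsum_timesBefore u u rfl, M.tsum_timesBefore (u + ω) (u + ω) rfl,
      ← hs1.tsum_sub (hM.summable_nat u), hS, ← tsum_mul_left, ← tsum_mul_left]
    rw [← Real.norm_eq_abs]
    refine tsum_of_norm_bounded ((hM.summable_exp.mul_left _).mul_left _).hasSum fun j => ?_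
    rw [Real.norm_eq_abs]
    have h1 := sub_nonneg.1 (hM.sub_apply_nonneg (u + ω) j)
    have h2 := sub_nonneg.1 (hM.sub_apply_nonneg u j)
    have h3 := hM.cauchy_le h1
    have h4 := hM.cauchy_nonneg (u + ω) (M.t (firstIndex M.t (u + ω) - 1 - j))
    have h5 : C * Real.exp (-(c * (u + ω - M.t (firstIndex M.t (u + ω) - 1 - j)))) ≤
      C * Real.exp (j * (-(c * η))) := mul_le_mul_of_nonneg_left (hM.exp_le (u + ω) j) hC.le
    rw [huq, show firstIndex M.t u + q - 1 - (j : ℤ) = firstIndex M.t u - 1 - j + q by ring]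
      at h1 h3 h4 h5 ⊢
    set k := firstIndex M.t u - 1 - (j : ℤ)
    -- In the series t k corresponds to t (k + q), which only approximates t k + ω; the Cauchy
    -- matrix estimate allows a free s' for this purpose.
    have h6 := hKq u (M.t k) (M.t (k + q)) h2 h1
      (by rw [sub_add_eq_sub_sub]; exact (ht k).le.trans hξε) huq
      (by rw [hT.firstIndex_apply, hT.firstIndex_apply])
    have h7 : ε * (K * Real.exp (-(c * (u - M.t k)))) ≤ ε * (K * Real.exp (j * (-(c * η)))) := by
      gcongr ε * (K * ?_)
      exact hM.exp_le u j
    set e := Real.exp (j * (-(c * η)))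
    have h8 := hδ k
    have h9 := hM.δ_le k
    calc |M.cauchy (u + ω) (M.t (k + q)) * M.δ (k + q) - M.cauchy u (M.t k) * M.δ k|
        = |M.cauchy (u + ω) (M.t (k + q)) * (M.δ (k + q) - M.δ k) +
            (M.cauchy (u + ω) (M.t (k + q)) - M.cauchy u (M.t k)) * M.δ k| := by ring_nf
      _ ≤ C * e * ε + ε * (K * e) * D := by
          refine (abs_add_le _ _).trans ?_
          rw [abs_mul, abs_mul, abs_of_nonneg h4]
          gcongr
          · exact h3.trans h5
          · exact h6.trans h7
      _ = ε * ((C + K * D) * e) := by ring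
  set E := Real.exp (-(c * R))
  have hE0 : 0 < E := Real.exp_pos _
  calc _ = |((∫ s in Iic (u + ω), M.cauchy (u + ω) s * N s) - ∫ s in Iic u, M.cauchy u s * N s) +
        ((∑' k : {k : ℤ // M.t k < u + ω}, M.cauchy (u + ω) (M.t k) * M.δ k) -
          ∑' k : {k : ℤ // M.t k < u}, M.cauchy u (M.t k) * M.δ k)| := by
        rw [response, response]; ring_nf
    _ ≤ K' * (ε / c + E / c + ρ) + ε * ((C + K * D) * S) :=
        (abs_add_le _ _).trans (add_le_add hint hsum)
    _ ≤ K' * ((1 / c + 1) * (ε + E + ρ)) + (C + K * D) * S * (ε + E + ρ) := by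
        have h1 : 0 ≤ 1 / c := by positivity
        have h2 : ε / c + E / c + ρ ≤ (1 / c + 1) * (ε + E + ρ) := by
          rw [div_eq_mul_one_div ε, div_eq_mul_one_div E]
          nlinarith [mul_nonneg h1 hρ]
        have h3 : 0 ≤ (C + K * D) * S := by positivity
        rw [mul_comm ε]
        gcongr
        linarith
    _ = _ := by ring

theorem isPLC_response (hM : M.LinearBounds c A C D η) (hN : AEStronglyMeasurable N)
    (hB : ∀ s, |N s| ≤ B) : IsPLC M.t (M.response N) := by
  obtain ⟨L, hL, hLip⟩ := hM.exists_lipschitz_response hN hB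
  have hT := M.isTimeSequence
  -- On each half-open interval the response is Lipschitz, hence the restriction of a continuous
  -- function on ℝ, which supplies all one-sided limits.
  have hext : ∀ k, ∃ g : ℝ → ℝ, Continuous g ∧
      EqOn (M.response N) g (Ioc (M.t (k - 1)) (M.t k)) := by
    intro k
    have h : LipschitzOnWith L.toNNReal (M.response N) (Ioc (M.t (k - 1)) (M.t k)) := by
      refine LipschitzOnWith.of_dist_le_mul fun x hx y hy => ?_
      rw [Real.coe_toNNReal _ hL.le]
      exact hLip y x ((hT.firstIndex_eq_iff.2 hx).trans (hT.firstIndex_eq_iff.2 hy).symm)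
    obtain ⟨g, hg, hgE⟩ := h.extend_real
    exact ⟨g, hg.continuous, hgE⟩
  have hlt : ∀ k, M.t (k - 1) < M.t k := fun k => hT.strictMono (by omega)
  refine ⟨fun s hs => ?_, fun k => ?_, fun k => ?_⟩
  · obtain ⟨h1, h2⟩ := hT.firstIndex_eq_iff.1 (rfl : firstIndex M.t s = _)
    obtain ⟨g, hg, hgE⟩ := hext (firstIndex M.t s)
    refine hg.continuousAt.congr ?_
    filter_upwards [Ioo_mem_nhds h1 (lt_of_le_of_ne h2 (hs _))] with z hz
    exact (hgE ⟨hz.1, hz.2.le⟩).symm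
  · obtain ⟨g, hg, hgE⟩ := hext k
    rw [hgE ⟨hlt k, le_rfl⟩]
    refine (hg.continuousAt.tendsto.mono_left nhdsWithin_le_nhds).congr' ?_
    filter_upwards [Ioo_mem_nhdsLT (hlt k)] with z hz
    exact (hgE ⟨hz.1, hz.2.le⟩).symm
  · obtain ⟨g, hg, hgE⟩ := hext (k + 1)
    have hlt' := hlt (k + 1)
    rw [add_sub_cancel_right] at hgE hlt'
    refine ⟨g (M.t k), (hg.continuousAt.tendsto.mono_left nhdsWithin_le_nhds).congr' ?_⟩
    filter_upwards [Ioo_mem_nhdsGT hlt'] with z hz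
    exact (hgE ⟨hz.1, hz.2.le⟩).symm

theorem piecewiseAlmostPeriodic_response (hM : M.LinearBounds c A C D η)
    (ha : BohrAlmostPeriodic M.a) (hγ : AlmostPeriodicSeq M.γ) (hδ : AlmostPeriodicSeq M.δ)
    (ht : UniformlyAlmostPeriodicDifferences M.t) (hN : AEStronglyMeasurable N)
    (hB : ∀ s, |N s| ≤ B) (hNap : AlmostPeriodicInMeasure N) :
    PiecewiseAlmostPeriodic M.t (M.response N) := by
  have hT := M.isTimeSequence
  refine ⟨hM.isPLC_response hN hB, ht, fun ε hε => ?_, fun ε hε => ?_⟩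
  · obtain ⟨L, hL, hLip⟩ := hM.exists_lipschitz_response hN hB
    refine ⟨ε / L, by positivity, fun k s hs s' hs' hss => ?_⟩
    have hi : ∀ x ∈ Ioc (M.t k) (M.t (k + 1)), firstIndex M.t x = k + 1 := fun x hx =>
      hT.firstIndex_eq_iff.2 ⟨by rw [add_sub_cancel_right]; exact hx.1, hx.2⟩
    refine (hLip s' s ((hi s hs).trans (hi s' hs').symm)).trans_lt ?_
    rw [lt_div_iff₀ hL] at hss
    linarith
  · obtain ⟨Q, hQ, hQM⟩ := hM.abs_response_sub_le hN hB
    -- The coefficient errors, the tail before u - R and the exceptional set contribute at most r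
    -- each, and 3 Q r < ε.
    set r := ε / (4 * Q) with hr
    have hr0 : 0 < r := by positivity
    obtain ⟨R, hR, hRr⟩ : ∃ R : ℝ, 0 < R ∧ Real.exp (-(c * R)) < r := by
      have h1 : Tendsto (fun R : ℝ => Real.exp (-(c * R))) atTop (𝓝 0) :=
        Real.tendsto_exp_neg_atTop_nhds_zero.comp (tendsto_id.const_mul_atTop hM.c_pos)
      exact ((eventually_gt_atTop 0).and (h1.eventually_lt_const hr0)).exists
    set ε' := min 1 (min r (r / 2)) with hε'
    have hε'0 : 0 < ε' := by positivity
    have hε'r : ε' ≤ r := (min_le_right _ _).trans (min_le_left _ _)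
    have hε'r2 : ε' ≤ r / 2 := (min_le_right _ _).trans (min_le_right _ _)
    obtain ⟨ξ₀, hξ₀, hξv⟩ := hT.exists_volume_nhds_le hM.η_pos hM.gap hR (half_pos hr0)
    set ξ := min ξ₀ (min ε' ε) with hξ
    have hξ0 : 0 < ξ := by positivity
    refine (hT.isRelativelyDense_of_eventually ht hξ0
      ((ha.eventually hε'0).and (hNap R hR ε' hε'0))
      ((hγ.eventually hε'0).and (hδ.eventually hε'0))).mono ?_
    rintro ω ⟨⟨h1, h2⟩, q, ⟨h3, h4⟩, h5⟩ u hu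
    have hvol : ∀ x, volume {s ∈ Icc x (x + R) | ε' ≤ |N (s + ω) - N s| ∨ ∃ k, |s - M.t k| ≤ ξ} ≤
        ENNReal.ofReal r := fun x =>
      volume_setOf_or_le hε'0.le (half_pos hr0).le (by linarith) (h2 x)
        (hξv ξ (min_le_left _ _) x) fun _ h => h
    have h6 := hQM ε' r R ξ hξ0 ((min_le_right _ _).trans (min_le_left _ _)) (min_le_left _ _)
      hr0.le ω q (fun s => (h1 s).le) (fun k => (h3 k).le) (fun k => (h4 k).le) h5 hvol u
      fun k => ((min_le_right _ _).trans (min_le_right _ _)).trans_lt (hu k)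
    calc _ ≤ Q * (ε' + Real.exp (-(c * R)) + r) := h6
      _ ≤ Q * (r + r + r) := by gcongr
      _ < 4 * Q * r := by nlinarith [mul_pos hQ hr0]
      _ = ε := by rw [hr]; field_simp

end LinearBounds

/-! ### The nonlinear terms -/

/-- For α < 1 the function is not Lipschitz at 0, but uniform continuity on the bounded range of φ
is enough. -/
theorem uniformContinuousOn_hill {α : ℝ} (hα : 0 < α) (B : ℝ) :
    UniformContinuousOn (fun x : ℝ => 1 / (1 + x ^ α)) (Icc 0 B) := by
  refine isCompact_Icc.uniformContinuousOn_of_continuous fun x hx => ?_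
  refine ContinuousAt.continuousWithinAt (ContinuousAt.div continuousAt_const
    (continuousAt_const.add (Real.continuousAt_rpow_const _ _ (Or.inr hα.le))) ?_)
  have := Real.rpow_nonneg hx.1 α
  positivity

theorem abs_hill_le {x : ℝ} (hx : 0 ≤ x) (α : ℝ) : |1 / (1 + x ^ α)| ≤ 1 := by
  have := Real.rpow_nonneg hx α
  rw [abs_of_nonneg (by positivity), div_le_one (by positivity)]
  linarith

theorem measurable_hill {f : ℝ → ℝ} (hf : Measurable f) (α : ℝ) :
    Measurable fun s => 1 / (1 + f s ^ α) :=
  measurable_const.div (measurable_const.add (hf.pow_const α))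

section Nonlinearity

variable {φ : ℝ → ℝ}

theorem integrableOn_kernel_mul (M : Model m) (hφm : Measurable φ) (hφ0 : ∀ s, 0 ≤ φ s)
    (i : Fin m) (s : ℝ) :
    IntegrableOn (fun r => M.v i r * (1 / (1 + φ (s - r) ^ M.β i))) (Ioc 0 M.T) := by
  refine Integrable.mul_bdd (c := 1) ((M.v_integrable i).mono_set Ioc_subset_Icc_self) ?_
    (.of_forall fun r => abs_hill_le (hφ0 _) _)
  exact (measurable_hill (hφm.comp (measurable_const.sub measurable_id)) _).aestronglyMeasurable

theorem abs_distributed_le (M : Model m) (hφ0 : ∀ s, 0 ≤ φ s) (i : Fin m) (s : ℝ) :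
    |∫ r in 0..M.T, M.v i r * (1 / (1 + φ (s - r) ^ M.β i))| ≤ ∫ r in 0..M.T, |M.v i r| := by
  have hv : IntervalIntegrable (M.v i) volume 0 M.T :=
    (intervalIntegrable_iff_integrableOn_Ioc_of_le M.T_pos.le).2
      ((M.v_integrable i).mono_set Ioc_subset_Icc_self)
  rw [← Real.norm_eq_abs]
  refine intervalIntegral.norm_integral_le_of_norm_le M.T_pos.le (.of_forall fun r _ => ?_) hv.abs
  rw [norm_mul]
  exact mul_le_of_le_one_right (norm_nonneg _) (abs_hill_le (hφ0 _) _)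

theorem aestronglyMeasurable_distributed (M : Model m) (hφm : Measurable φ) (i : Fin m) :
    AEStronglyMeasurable fun s =>
      ∫ r in 0..M.T, M.v i r * (1 / (1 + φ (s - r) ^ M.β i)) := by
  simp only [intervalIntegral.integral_of_le M.T_pos.le]
  have h : AEStronglyMeasurable (fun p : ℝ × ℝ => M.v i p.2 * (1 / (1 + φ (p.1 - p.2) ^ M.β i)))
      (volume.prod (volume.restrict (Ioc 0 M.T))) := by
    refine AEStronglyMeasurable.mul ?_ ?_
    · exact ((M.v_integrable i).mono_set Ioc_subset_Icc_self).aestronglyMeasurable.comp_snd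
    · exact (measurable_const.div (measurable_const.add
        ((hφm.comp (measurable_fst.sub measurable_snd)).pow_const _))).aestronglyMeasurable
  exact h.integral_prod_right'

theorem measurable_harvesting (hA3 : M.HarvestingAssumption) (i : Fin m) {f : ℝ → ℝ}
    (hf : Measurable f) (hf0 : ∀ s, 0 ≤ f s) : Measurable fun s => M.h i s (f s) := by
  -- `M.h i` is continuous only for x ≥ 0; truncating x at 0 makes it continuous on the plane
  -- without changing its values along f.
  have hc : Continuous fun p : ℝ × ℝ => M.h i p.1 (max p.2 0) := by
    have h1 := (hA3 i).2.1.1.comp_continuous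
      (f := fun p : ℝ × ℝ => (p.1, max p.2 0))
      (continuous_fst.prodMk (continuous_snd.max continuous_const))
      fun p => ⟨mem_univ _, le_max_right p.2 0⟩
    exact h1
  have h2 := hc.measurable.comp (measurable_id.prodMk hf)
  convert h2 using 2 with s
  simp [max_eq_left (hf0 s)]

theorem nonlinearity_eq (M : Model m) (φ : ℝ → ℝ) : M.nonlinearity φ = fun s =>
    ∑ i, (M.b i s * (1 / (1 + φ (s - M.τ i s) ^ M.α i))
      + M.c i s * (∫ r in 0..M.T, M.v i r * (1 / (1 + φ (s - r) ^ M.β i)))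
      - M.h i s (φ (s - M.σ i s))) := by
  funext s
  simp only [nonlinearity, mul_one_div]

theorem aestronglyMeasurable_nonlinearity (hA2 : M.ProductionAssumption)
    (hA3 : M.HarvestingAssumption) (hA4 : M.DelayAssumption) (hφm : Measurable φ)
    (hφ0 : ∀ s, 0 ≤ φ s) : AEStronglyMeasurable (M.nonlinearity φ) := by
  rw [nonlinearity_eq]
  refine Finset.aestronglyMeasurable_fun_sum _ fun i _ => ?_
  have hτ := hφm.comp (measurable_id.sub (hA4 i).1.1.1.measurable)
  have hσ := hφm.comp (measurable_id.sub (hA4 i).2.1.1.measurable)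
  refine ((?_ : AEStronglyMeasurable _ _).add (?_ : AEStronglyMeasurable _ _)).sub ?_
  · exact ((hA2 i).1.1.measurable.mul (measurable_hill hτ _)).aestronglyMeasurable
  · exact (hA2 i).2.1.aestronglyMeasurable.mul (M.aestronglyMeasurable_distributed hφm i)
  · exact (measurable_harvesting hA3 i hσ fun s => hφ0 _).aestronglyMeasurable

theorem exists_abs_nonlinearity_le (hA2 : M.ProductionAssumption)
    (hA3 : M.HarvestingAssumption) (hφ0 : ∀ s, 0 ≤ φ s) :
    ∃ B, ∀ s, |M.nonlinearity φ s| ≤ B := by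
  have h : ∀ i, ∃ B, ∀ s, |M.b i s * (1 / (1 + φ (s - M.τ i s) ^ M.α i))
      + M.c i s * (∫ r in 0..M.T, M.v i r * (1 / (1 + φ (s - r) ^ M.β i)))
      - M.h i s (φ (s - M.σ i s))| ≤ B := by
    intro i
    obtain ⟨b, hb0, hb⟩ := (hA2 i).1.bounded
    obtain ⟨c, hc0, hc⟩ := (hA2 i).2.bounded
    obtain ⟨H, hH⟩ := (hA3 i).1
    refine ⟨b * 1 + c * (∫ r in 0..M.T, |M.v i r|) + H, fun s => ?_⟩
    refine (abs_sub _ _).trans (add_le_add ((abs_add_le _ _).trans (add_le_add ?_ ?_)) ?_)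
    · rw [abs_mul]
      gcongr
      exacts [hb s, abs_hill_le (hφ0 _) _]
    · rw [abs_mul]
      gcongr
      exacts [hc s, M.abs_distributed_le hφ0 i s]
    · rw [abs_of_nonneg (M.h_nonneg i _ _ (hφ0 _))]
      exact hH _ _ (hφ0 _)
  choose B hB using h
  refine ⟨∑ i, B i, fun s => ?_⟩
  rw [nonlinearity_eq]
  exact (Finset.abs_sum_le_sum_abs _ _).trans (Finset.sum_le_sum fun i _ => hB i s)

theorem almostPeriodicInMeasure_nonlinearity (hA2 : M.ProductionAssumption)
    (hA3 : M.HarvestingAssumption) (hA4 : M.DelayAssumption) (hA7 : M.ImpulseTimeAssumption)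
    (hφ : PiecewiseAlmostPeriodic M.t φ) (hφ0 : ∀ s, 0 ≤ φ s) :
    AlmostPeriodicInMeasure (M.nonlinearity φ) := by
  obtain ⟨_, η, hη, hgap⟩ := hA7
  have hT := M.isTimeSequence
  obtain ⟨B, _, hB⟩ := hφ.bounded hT hη hgap
  have hI : ∀ s, φ s ∈ Icc 0 B := fun s => ⟨hφ0 s, (le_abs_self _).trans (hB s)⟩
  rw [nonlinearity_eq]
  refine .sum _ fun i => .sub (.add ?_ ?_) ?_
  · obtain ⟨b, _, hb⟩ := (hA2 i).1.bounded
    exact (hA2 i).1.inMeasure.mul ((hφ.inMeasure_delay hT hη hgap (hA4 i).1).comp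
      (uniformContinuousOn_hill (M.α_pos i) B) fun s => hI _) hb fun s => abs_hill_le (hφ0 _) _
  · obtain ⟨c, _, hc⟩ := (hA2 i).2.bounded
    refine (hA2 i).2.inMeasure.mul (.of_uniform ?_) hc (M.abs_distributed_le hφ0 i)
    exact ((hφ.inMeasure hT hη hgap).comp (uniformContinuousOn_hill (M.β_pos i) B) hI).convolution
      (measurable_hill hφ.isPLC.measurable _) (fun s => abs_hill_le (hφ0 s) _) M.T_pos
      (M.v_integrable i)
  · obtain ⟨_, hh, L, hL, hLip⟩ := hA3 i
    exact (hφ.inMeasure_delay hT hη hgap (hA4 i).2).comp_lipschitz hh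
      (K := Icc 0 B) (fun x hx => hx.1) isCompact_Icc (fun s => hI _) hL
      fun s x hx y hy => hLip s x y hx.1 hy.1

end Nonlinearity

end Model

end Hematopoiesis
end

/-! ### Assembly: the response to the nonlinear terms -/

theorem theorem3p1 {m : ℕ} (M : Hematopoiesis.Model m)
    (hA1 : M.DecayAssumption) (hA2 : M.ProductionAssumption) (hA3 : M.HarvestingAssumption)
    (hA4 : M.DelayAssumption) (hA5 : Hematopoiesis.AlmostPeriodicSeq M.δ)
    (hA6 : M.JumpFactorAssumption) (hA7 : M.ImpulseTimeAssumption)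
    (φ : ℝ → ℝ) (hφ : Hematopoiesis.PiecewiseAlmostPeriodic M.t φ) (hφ0 : ∀ s, 0 ≤ φ s) :
    -- the integrals and the series that define `F φ` converge absolutely
    (∀ i s, IntervalIntegrable (fun r => M.v i r / (1 + φ (s - r) ^ M.β i)) volume 0 M.T) ∧
    (∀ u, IntegrableOn (fun s => M.cauchy u s * M.nonlinearity φ s) (Iic u)) ∧
    (∀ u, Summable fun k : {k : ℤ // M.t k < u} => M.cauchy u (M.t k) * M.δ k) ∧
    -- and `F φ` is almost periodic
    Hematopoiesis.PiecewiseAlmostPeriodic M.t (M.F φ) := by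
  obtain ⟨c, A, C, D, η, hM⟩ := Hematopoiesis.Model.exists_linearBounds hA1 hA5 hA6 hA7
  obtain ⟨B, hB⟩ := Hematopoiesis.Model.exists_abs_nonlinearity_le hA2 hA3 hφ0
  have hφm := hφ.isPLC.measurable
  have hN := Hematopoiesis.Model.aestronglyMeasurable_nonlinearity hA2 hA3 hA4 hφm hφ0
  refine ⟨fun i s => ?_, hM.integrableOn hN hB, hM.summable, ?_⟩
  · rw [intervalIntegrable_iff_integrableOn_Ioc_of_le M.T_pos.le]
    simpa only [mul_one_div] using M.integrableOn_kernel_mul hφm hφ0 i s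
  -- `M.F φ` is by definition `M.response (M.nonlinearity φ)`.
  · exact hM.piecewiseAlmostPeriodic_response hA1.1 hA6.1 hA5 hA7.1 hN hB
      (Hematopoiesis.Model.almostPeriodicInMeasure_nonlinearity hA2 hA3 hA4 hA7 hφ hφ0)
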